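/- Let $\mathcal{Q}$ be a bipartite quiver with finite vertex set $V=V_{\rm source}\sqcup V_{\rm sink}$ and arrows $h_1,\dots,h_r$, so that every arrow $h_k$ has source $s(h_k)\in V_{\rm source}$ and target $t(h_k)\in V_{\rm sink}$. Let $\mathbf{m}=(m_\gamma)_{\gamma\in V}$ and $\mathbf{u}=(u_\gamma)_{\gamma\in V}$ be tuples of nonnegative integers and let $K$ be a field. For $1\le k\le r$ let $X^{(k)}=[x^{(k)}_{ij}]$ be an $m_{t(h_k)}\times m_{s(h_k)}$ matrix of variables, all the variables $x^{(k)}_{ij}$ being independent, and let $K[X]$ be the polynomial ring over $K$ in all of them. For $\alpha\in V_{\rm sink}$ put $A_\alpha=[X^{(k_1)}\,|\,X^{(k_2)}\,|\cdots|\,X^{(k_s)}]$, where $k_1<\dots<k_s$ are the indices of all the arrows with target $\alpha$. For $\beta\in V_{\rm source}$ let $A_\beta$ be the matrix obtained by stacking $X^{(k_1)},X^{(k_2)},\dots,X^{(k_t)}$ from top to bottom, where $k_1<\dots<k_t$ are the indices of all the arrows with source $\beta$. Let $I_{\mathcal{Q},\mathbf{m},\mathbf{u}}\subseteq K[X]$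 be the ideal generated by the set $\mathcal{G}$ of all $(u_\gamma+1)$-minors of $A_\gamma$, for all $\gamma\in V$. Let $>$ be any lexicographic monomial order on $K[X]$ that is consistent with $A_\gamma$ for every $\gamma\in V$, that is, in each matrix $A_\gamma$ the variables strictly decrease from left to right along every row and from top to bottom along every column. Theorem. The set $\mathcal{G}$ is a Gröbner basis of $I_{\mathcal{Q},\mathbf{m},\mathbf{u}}$ with respect to $>$; that is, $\mathcal{G}$ is a finite generating set of $I_{\mathcal{Q},\mathbf{m},\mathbf{u}}$, and the leading terms of the elements of $\mathcal{G}$ generate the ideal generated by the leading terms of all elements of $I_{\mathcal{Q},\mathbf{m},\mathbf{u}}$. -/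

import Mathlib

namespace BipartiteDeterminantal

/-! ### Gröbner bases and monomial orders -/

section GroebnerBasis

open MvPolynomial

open scoped MonomialOrder

/-- The initial ideal `LT(I)`, generated by the leading terms of the elements of `I`. -/
noncomputable def initialIdeal {σ K : Type*} [Field K] (mo : MonomialOrder σ)
    (I : Ideal (MvPolynomial σ K)) : Ideal (MvPolynomial σ K) :=
  Ideal.span (mo.leadingTerm '' (I : Set (MvPolynomial σ K)))

/-- `G` is a Gröbner basis of the ideal `I` with respect to `mo`: it is a finite set that
generates `I`, and the leading terms of its elements generate the initial ideal of `I`. -/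
structure IsGroebnerBasis {σ K : Type*} [Field K] (mo : MonomialOrder σ)
    (I : Ideal (MvPolynomial σ K)) (G : Set (MvPolynomial σ K)) : Prop where
  finite : G.Finite
  span_eq : Ideal.span G = I
  initialIdeal_eq : initialIdeal mo I = Ideal.span (mo.leadingTerm '' G)

/-- `varLT mo x y`: the variable `x` is smaller than the variable `y` in the monomial order
`mo`. -/
def varLT {σ : Type*} (mo : MonomialOrder σ) (x y : σ) : Prop :=
  Finsupp.single x 1 ≺[mo] Finsupp.single y 1

/-- `mo` is the lexicographic order attached to the linear order that it induces on the
variables: a monomial `a` is smaller than a monomial `b` if and only if, at the largest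
variable where their exponents differ, the exponent of `a` is smaller than that of `b`. -/
def IsLexicographic {σ : Type*} (mo : MonomialOrder σ) : Prop :=
  ∀ a b : σ →₀ ℕ, a ≺[mo] b ↔ ∃ x, a x < b x ∧ ∀ y, varLT mo x y → a y = b y

/-- The monomial order `mo` is consistent with a matrix `C` of variables: the variables decrease
from left to right along every row and from top to bottom along every column. -/
def IsConsistent {σ ρ κ : Type*} [LinearOrder ρ] [LinearOrder κ] (mo : MonomialOrder σ)
    (C : Matrix ρ κ σ) : Prop :=
  (∀ (i : ρ) (j j' : κ), j < j' → varLT mo (C i j') (C i j)) ∧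
    ∀ (i i' : ρ) (j : κ), i < i' → varLT mo (C i' j) (C i j)

/-- The set of `u`-minors of a matrix `A`: the determinants of the submatrices obtained by
choosing `u` rows and `u` columns, both in increasing order. -/
def minors {ρ κ R : Type*} [LinearOrder ρ] [LinearOrder κ] [CommRing R] (u : ℕ)
    (A : Matrix ρ κ R) : Set R :=
  {f | ∃ (rows : Fin u ↪o ρ) (cols : Fin u ↪o κ), f = (A.submatrix rows cols).det}

/-- The matrix of polynomials attached to a matrix of variables. -/
noncomputable def varMatrix {σ ρ κ : Type*} (K : Type*) [Field K] (C : Matrix ρ κ σ) :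
    Matrix ρ κ (MvPolynomial σ K) :=
  C.map X

end GroebnerBasis

/-! ### Bipartite quivers and their block matrices -/

/-- A bipartite structure on a quiver with vertex type `V` and `r` arrows: a partition of the
vertices into sources and sinks such that each arrow goes from a source to a sink, together with
an enumeration `h₁, …, hᵣ` of the arrows. -/
structure BipartiteQuiver (V : Type*) [Quiver V] (r : ℕ) where
  sources : Set V
  sinks : Set V
  isCompl : IsCompl sources sinks
  arrow : Fin r ≃ Quiver.Total V
  left_mem : ∀ k, (arrow k).left ∈ sources
  right_mem : ∀ k, (arrow k).right ∈ sinks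

namespace BipartiteQuiver

variable {V : Type*} [Quiver V] {r : ℕ} (Q : BipartiteQuiver V r) (m : V → ℕ)

/-- The source of the `k`-th arrow. -/
def src (k : Fin r) : V := (Q.arrow k).left

/-- The target of the `k`-th arrow. -/
def tgt (k : Fin r) : V := (Q.arrow k).right

/-- The variables: `⟨k, i, j⟩` is the entry in row `i` and column `j` of the variable matrix
`X⁽ᵏ⁾`, which has size `m (tgt k) × m (src k)`. -/
@[ext]
structure Var where
  page : Fin r
  row : Fin (m (Q.tgt page))
  col : Fin (m (Q.src page))

/-- The matrix `A_α = [X⁽ᵏ¹⁾ | X⁽ᵏ²⁾ | ⋯]` of variables, where `k₁ < k₂ < ⋯` are the indices of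
the arrows with target `α`. Its columns are pairs `(k, j)` of the index `k` of such an arrow and a
column `j` of `X⁽ᵏ⁾`, in lexicographic order. -/
def sinkMatrix (α : V) :
    Matrix (Fin (m α)) (Σₗ k : {k : Fin r // Q.tgt k = α}, Fin (m (Q.src k))) (Q.Var m) :=
  fun i c ↦
    { page := (ofLex c).1
      row := Fin.cast (congrArg m (ofLex c).1.2.symm) i
      col := (ofLex c).2 }

/-- The matrix `A_β` of variables, obtained by putting `X⁽ᵏ¹⁾, X⁽ᵏ²⁾, …` below each other, where
`k₁ < k₂ < ⋯` are the indices of the arrows with source `β`. Its rows are pairs `(k, i)` of the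
index `k` of such an arrow and a row `i` of `X⁽ᵏ⁾`, in lexicographic order. -/
def sourceMatrix (β : V) :
    Matrix (Σₗ k : {k : Fin r // Q.src k = β}, Fin (m (Q.tgt k))) (Fin (m β)) (Q.Var m) :=
  fun c j ↦
    { page := (ofLex c).1
      row := (ofLex c).2
      col := Fin.cast (congrArg m (ofLex c).1.2.symm) j }

/-- The natural generators: the `(u γ + 1)`-minors of `A_γ` for all vertices `γ`. -/
def naturalGenerators (u : V → ℕ) (K : Type*) [Field K] : Set (MvPolynomial (Q.Var m) K) :=
  (⋃ α ∈ Q.sinks, minors (u α + 1) (varMatrix K (Q.sinkMatrix m α))) ∪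
    ⋃ β ∈ Q.sources, minors (u β + 1) (varMatrix K (Q.sourceMatrix m β))

/-- The bipartite determinantal ideal, generated by the natural generators. -/
noncomputable def bipartiteDeterminantalIdeal (u : V → ℕ) (K : Type*) [Field K] :
    Ideal (MvPolynomial (Q.Var m) K) :=
  Ideal.span (Q.naturalGenerators m u K)

/-- The monomial order `mo` is consistent with `A_γ` for every vertex `γ`. -/
def IsConsistentWithAll (mo : MonomialOrder (Q.Var m)) : Prop :=
  (∀ α ∈ Q.sinks, IsConsistent mo (Q.sinkMatrix m α)) ∧
    ∀ β ∈ Q.sources, IsConsistent mo (Q.sourceMatrix m β)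

end BipartiteQuiver

end BipartiteDeterminantal

/-!
# Natural generators of bipartite determinantal ideals are a Gröbner basis

The leading term of a minor is the product of its main diagonal, so the leading terms of the natural
generators are the products over long chains: `u γ + 1` variables that move strictly down and right
in the matrix `A_γ`. It has to be shown that the leading monomial of every nonzero `f` in the ideal
contains a long chain. Instead of reducing S-polynomials, the proof only uses that `f` vanishes at
all points, with coordinates in an infinite field, at which `A_γ` has rank at most `u γ`.

The variables are removed one at a time, from the largest to the smallest. A state consists of the
set `Rem` of remaining variables and a set `S` of removed ones. Its points (`PageLayout.Points`) are
those where, for each `A_γ` and each `p ∈ Rem`, the block of `A_γ` below and right of `p` has rank at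
most `u γ - n` whenever `S` has a chain of `n` elements strictly above and left of `p`. By induction
on `Rem`, if `f ≠ 0` involves only variables in `Rem` and vanishes on the points of `(S, Rem)`, then
`S` and the leading monomial of `f` together contain a long chain
(`PageLayout.hasLongChain_of_vanishing`). Let `y` be the largest variable in `Rem`, let `d` be the
degree of `f` in `y`, and let `c` be the coefficient of `y ^ d`. For a lexicographic order the leading
monomial of `f` is `y ^ d` times that of `c`. Two facts carry the induction.

* If `d > 0`, then `c` vanishes on the points of `(S ∪ {y}, Rem \ {y})`. Such a point `x` is the limit
  for `s → 0` of points of `(S, Rem)` whose coordinate at `y` is `s⁻¹` (`PageLayout.deform`). These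
  are obtained by using the entry `s⁻¹` as a pivot, with row operations in the sink matrix of `y` and
  column operations in its source matrix. The pivot raises the rank of the block at `y` by one, and
  `x` leaves room for that. All other rank conditions are preserved (`PageLayout.SinkCond.deform`),
  since a chain in `S` that ends at a corner below and right of `y` also ends at that corner moved
  to the row or to the column of `y`. As `s ^ d * f` is polynomial in `s` along this family, its value
  `c x` at `s = 0` is zero.
* If `d = 0`, then `f` vanishes on the points of `(S, Rem \ {y})`. If in one of the two matrices of `y`
  the block strictly below and right of `y` has the maximal rank allowed, then the entry at `y` can be
  chosen so that all conditions hold (`PageLayout.exists_fill`): say in the sink matrix, the row of `y`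
  right of `y` is a combination of the rows below, and the same combination defines the entry and
  also settles the source matrix. Otherwise the deformation above applies.

Sinks and sources are interchanged by transposing all pages, so each argument is given for sinks only.
-/

namespace BipartiteDeterminantal

/-! ### Comparing ranks of matrices -/

section Rank

variable {L ι κ κ' : Type*} [Field L] [Finite ι] [Fintype κ]

theorem rank_le_of_cols_mem_span [Fintype κ'] {M : Matrix ι κ L} {N : Matrix ι κ' L}
    (h : ∀ c, M.col c ∈ Submodule.span L (Set.range N.col)) : M.rank ≤ N.rank := by
  rw [Matrix.rank_eq_finrank_span_cols, Matrix.rank_eq_finrank_span_cols]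
  exact Submodule.finrank_mono (Submodule.span_le.2 (Set.range_subset_iff.2 h))

theorem rank_le_of_rows_mem_span {ι' : Type*} [Finite ι'] {M : Matrix ι κ L} {N : Matrix ι' κ L}
    (h : ∀ i, M.row i ∈ Submodule.span L (Set.range N.row)) : M.rank ≤ N.rank := by
  rw [Matrix.rank_eq_finrank_span_row, Matrix.rank_eq_finrank_span_row]
  exact Submodule.finrank_mono (Submodule.span_le.2 (Set.range_subset_iff.2 h))

/-- If the row space of `M` lies in that of `N` and the rank of `N` is at most that of `M`, then
the two row spaces agree. -/
theorem row_mem_span_of_rank_le {ι' : Type*} [Finite ι'] {M : Matrix ι κ L} {N : Matrix ι' κ L}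
    (h : ∀ i, M.row i ∈ Submodule.span L (Set.range N.row)) (hr : N.rank ≤ M.rank) (i : ι') :
    N.row i ∈ Submodule.span L (Set.range M.row) := by
  rw [Matrix.rank_eq_finrank_span_row, Matrix.rank_eq_finrank_span_row] at hr
  rw [Submodule.eq_of_le_of_finrank_le (Submodule.span_le.2 (Set.range_subset_iff.2 h)) hr]
  exact Submodule.subset_span ⟨i, rfl⟩

omit [Finite ι] in
theorem rank_add_vecMulVec_le (M : Matrix ι κ L) (v : ι → L) (w : κ → L) :
    (M + Matrix.vecMulVec v w).rank ≤ M.rank + 1 := by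
  have h := Submodule.finrank_add_le_finrank_add_finrank (LinearMap.range M.mulVecLin)
    (LinearMap.range (Matrix.vecMulVec v w).mulVecLin)
  refine le_trans ?_ (h.trans (Nat.add_le_add_left (Matrix.rank_vecMulVec_le v w) _))
  refine Submodule.finrank_mono ?_
  rintro _ ⟨z, rfl⟩
  rw [Matrix.mulVecLin_add]
  exact Submodule.add_mem_sup ⟨z, rfl⟩ ⟨z, rfl⟩

end Rank

/-! ### Chains -/

section Chain

variable {τ : Type*}

/-- `HasChain lt S n p`: there are `z₁, …, zₙ` in `S` with `lt z₁ z₂`, …, `lt zₙ p`. -/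
inductive HasChain (lt : τ → τ → Prop) (S : Set τ) : ℕ → τ → Prop
  | zero (p : τ) : HasChain lt S 0 p
  | succ {n : ℕ} {z p : τ} : z ∈ S → lt z p → HasChain lt S n z → HasChain lt S (n + 1) p

theorem HasChain.mono {lt : τ → τ → Prop} {S T : Set τ} (hST : S ⊆ T) {n : ℕ} {p : τ}
    (h : HasChain lt S n p) : HasChain lt T n p := by
  induction h with
  | zero p => exact .zero p
  | succ hz hlt _ ih => exact .succ (hST hz) hlt ih

/-- Only the last element of the chain is compared with the end point. -/
theorem HasChain.imp_end {lt : τ → τ → Prop} {S : Set τ} {n : ℕ} {p q : τ}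
    (h : HasChain lt S n p) (hpq : ∀ z ∈ S, lt z p → lt z q) : HasChain lt S n q := by
  cases h with
  | zero => exact .zero q
  | succ hz hlt h => exact .succ hz (hpq _ hz hlt) h

/-- A chain is recorded by a sequence that increases strictly and ends at the given point. -/
theorem HasChain.exists_seq {lt : τ → τ → Prop} {S : Set τ}
    {n : ℕ} {p : τ} (h : HasChain lt S n p) (hp : p ∈ S) :
    ∃ c : Fin (n + 1) → τ, (∀ i, c i ∈ S) ∧ (∀ i : Fin n, lt (c i.castSucc) (c i.succ)) ∧
      c (Fin.last n) = p := by
  induction h with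
  | zero p => exact ⟨fun _ ↦ p, fun _ ↦ hp, fun i ↦ i.elim0, rfl⟩
  | @succ n z p hz hlt _ ih =>
    obtain ⟨c, hcS, hc, hlast⟩ := ih hz
    refine ⟨Fin.snoc (α := fun _ ↦ τ) c p, fun i ↦ ?_, fun i ↦ ?_, Fin.snoc_last _ _⟩
    · refine Fin.lastCases ?_ (fun i ↦ ?_) i
      · rwa [Fin.snoc_last]
      · rw [Fin.snoc_castSucc]; exact hcS i
    · rw [Fin.snoc_castSucc]
      refine Fin.lastCases ?_ (fun i ↦ ?_) i
      · rw [Fin.succ_last, Fin.snoc_last, hlast]; exact hlt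
      · rw [Fin.succ_castSucc, Fin.snoc_castSucc]; exact hc i

end Chain

/-! ### Layouts of pages -/

/-- A family of rectangular pages, indexed by `π`, with rows in `ρ` and columns in `κ`. Pages with
the same `tgt` are put next to each other and share their rows; pages with the same `src` are put
below each other and share their columns. The page sizes are recorded by the set of `cells`, a cell
being a triple (page, row, column). -/
structure PageLayout (π ρ κ A B : Type*) where
  tgt : π → A
  src : π → B
  cells : Set (π × ρ × κ)
  rect_tgt : ∀ {k k' i i' j j'}, (k, i, j) ∈ cells → (k', i', j') ∈ cells → tgt k = tgt k' →
    (k', i, j') ∈ cells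
  rect_src : ∀ {k k' i i' j j'}, (k, i, j) ∈ cells → (k', i', j') ∈ cells → src k = src k' →
    (k', i', j) ∈ cells

/-- Interchange of rows and columns. -/
def flip {π ρ κ : Type*} (p : π × ρ × κ) : π × κ × ρ := (p.1, p.2.2, p.2.1)

@[simp] theorem flip_flip {π ρ κ : Type*} (p : π × ρ × κ) : flip (flip p) = p := rfl

theorem flip_injective {π ρ κ : Type*} : Function.Injective (flip : π × ρ × κ → π × κ × ρ) :=
  fun p q h ↦ by rw [← flip_flip p, h, flip_flip]

/-- The position of the column of a cell in the matrix of its target, where pages come first. -/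
abbrev colPos {π ρ κ : Type*} (p : π × ρ × κ) : π ×ₗ κ := toLex (p.1, p.2.2)

namespace PageLayout

variable {π ρ κ A B : Type*} (D : PageLayout π ρ κ A B)

/-- The layout in which each page is transposed and sources and targets are interchanged. -/
def transpose : PageLayout π κ ρ B A where
  tgt := D.src
  src := D.tgt
  cells := {p | flip p ∈ D.cells}
  rect_tgt h h' e := D.rect_src h h' e
  rect_src h h' e := D.rect_tgt h h' e

/-! ### Blocks -/

section Block

variable {L : Type*} [Field L]

open Classical in
/-- The block of the matrix of the target `α` in the rows `R` and columns `C`, filled with zeros. -/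
noncomputable def block (x : π → ρ → κ → L) (α : A) (R : Set ρ) (C : Set (π ×ₗ κ)) :
    Matrix ρ (π × κ) L :=
  fun i c ↦ if D.tgt c.1 = α ∧ i ∈ R ∧ toLex c ∈ C then x c.1 i c.2 else 0

variable {D} {x x' : π → ρ → κ → L} {α : A} {R R' : Set ρ} {C C' : Set (π ×ₗ κ)}

theorem block_apply_of_mem {i : ρ} {c : π × κ} (hα : D.tgt c.1 = α) (hi : i ∈ R)
    (hc : toLex c ∈ C) : D.block x α R C i c = x c.1 i c.2 := if_pos ⟨hα, hi, hc⟩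

theorem block_apply_of_tgt_ne {i : ρ} {c : π × κ} (hα : D.tgt c.1 ≠ α) :
    D.block x α R C i c = 0 := if_neg fun h ↦ hα h.1

theorem block_apply_of_row_notMem {i : ρ} {c : π × κ} (hi : i ∉ R) :
    D.block x α R C i c = 0 := if_neg fun h ↦ hi h.2.1

theorem block_apply_of_col_notMem {i : ρ} {c : π × κ} (hc : toLex c ∉ C) :
    D.block x α R C i c = 0 := if_neg fun h ↦ hc h.2.2

theorem block_congr (h : ∀ k i j, D.tgt k = α → i ∈ R → toLex (k, j) ∈ C → x k i j = x' k i j) :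
    D.block x α R C = D.block x' α R C := by
  ext i c
  unfold block
  split_ifs with hc
  · exact h _ _ _ hc.1 hc.2.1 hc.2.2
  · rfl

theorem block_row_mem_span (hR : R ⊆ R') (i : ρ) :
    (D.block x α R C).row i ∈ Submodule.span L (Set.range (D.block x α R' C).row) := by
  by_cases hi : i ∈ R
  · refine Submodule.subset_span ⟨i, ?_⟩
    ext c
    have := hR hi
    by_cases h : D.tgt c.1 = α ∧ i ∈ R ∧ toLex c ∈ C
    · exact (if_pos (by tauto)).trans (if_pos h).symm
    · exact (if_neg (by tauto)).trans (if_neg h).symm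
  · convert Submodule.zero_mem _
    ext c
    exact block_apply_of_row_notMem hi

theorem block_col_mem_span (hC : C ⊆ C') (c : π × κ) :
    (D.block x α R C).col c ∈ Submodule.span L (Set.range (D.block x α R C').col) := by
  by_cases hc : toLex c ∈ C
  · refine Submodule.subset_span ⟨c, ?_⟩
    ext i
    have := hC hc
    by_cases h : D.tgt c.1 = α ∧ i ∈ R ∧ toLex c ∈ C
    · exact (if_pos (by tauto)).trans (if_pos h).symm
    · exact (if_neg (by tauto)).trans (if_neg h).symm
  · convert Submodule.zero_mem _
    ext i
    exact block_apply_of_col_notMem hc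

variable [Fintype π] [Fintype ρ] [Fintype κ]

theorem rank_block_mono (hR : R ⊆ R') (hC : C ⊆ C') :
    (D.block x α R C).rank ≤ (D.block x α R' C').rank :=
  (rank_le_of_rows_mem_span (block_row_mem_span hR)).trans
    (rank_le_of_cols_mem_span (block_col_mem_span hC))

end Block

/-! ### Corners and rank conditions -/

variable [LinearOrder π] [LinearOrder ρ] [LinearOrder κ]

/-- Both cells lie in the matrix of the same target, the first strictly above and strictly left of
the second. The analogous relation for sources is `D.transpose.SinkLT (flip z) (flip p)`. -/
def SinkLT (z p : π × ρ × κ) : Prop :=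
  D.tgt z.1 = D.tgt p.1 ∧ z.2.1 < p.2.1 ∧ colPos z < colPos p

/-- The weak form of `SinkLT`. -/
def SinkLE (z p : π × ρ × κ) : Prop :=
  D.tgt z.1 = D.tgt p.1 ∧ z.2.1 ≤ p.2.1 ∧ colPos z ≤ colPos p

/-- `y` is the corner that is about to be removed: the cells in `Rem` are those that remain after
it, and those in `S` were removed before. In the two matrices that contain `y`, nothing in `Rem` is
above and left of `y`, everything below and right of `y` is in `Rem`, and nothing there is in `S`. -/
structure IsCorner (S Rem : Set (π × ρ × κ)) (y : π × ρ × κ) : Prop where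
  mem : y ∈ D.cells
  subset : Rem ⊆ D.cells
  not_le : ∀ p ∈ Rem, ¬ D.SinkLE p y
  mem_of_le : ∀ p ∈ D.cells, D.SinkLE y p → p ≠ y → p ∈ Rem
  not_ge : ∀ z ∈ S, ¬ D.SinkLE y z
  not_le' : ∀ p ∈ Rem, ¬ D.transpose.SinkLE (flip p) (flip y)
  mem_of_le' : ∀ p ∈ D.cells, D.transpose.SinkLE (flip y) (flip p) → p ≠ y → p ∈ Rem
  not_ge' : ∀ z ∈ S, ¬ D.transpose.SinkLE (flip y) (flip z)

variable {D} in
theorem IsCorner.transpose {S Rem : Set (π × ρ × κ)} {y : π × ρ × κ} (h : D.IsCorner S Rem y) :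
    D.transpose.IsCorner (flip '' S) (flip '' Rem) (flip y) where
  mem := h.mem
  subset := by rintro _ ⟨p, hp, rfl⟩; exact h.subset hp
  not_le := by rintro _ ⟨p, hp, rfl⟩; exact h.not_le' p hp
  mem_of_le p hp hle hne :=
    ⟨flip p, h.mem_of_le' (flip p) hp hle (by rintro rfl; exact hne rfl), rfl⟩
  not_ge := by rintro _ ⟨p, hp, rfl⟩; exact h.not_ge' p hp
  not_le' := by rintro _ ⟨p, hp, rfl⟩; exact h.not_le p hp
  mem_of_le' p hp hle hne :=
    ⟨flip p, h.mem_of_le (flip p) hp hle (by rintro rfl; exact hne rfl), rfl⟩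
  not_ge' := by rintro _ ⟨p, hp, rfl⟩; exact h.not_ge p hp

section Cond

variable {L : Type*} [Field L] [Fintype π] [Fintype ρ] [Fintype κ]

/-- The rank conditions at the remaining corners: the block below and right of `p ∈ Rem` has rank at
most `u` minus the length of any chain in `S` that ends above and left of `p`. -/
def SinkCond (u : A → ℕ) (S Rem : Set (π × ρ × κ)) (x : π → ρ → κ → L) : Prop :=
  ∀ p ∈ Rem, ∀ n, HasChain D.SinkLT S n p →
    (D.block x (D.tgt p.1) (Set.Ici p.2.1) (Set.Ici (colPos p))).rank + n ≤ u (D.tgt p.1)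

variable {D} {x : π → ρ → κ → L}

/-- If `x` vanishes outside the cells, then a nonzero block is contained in the block below and
right of one of its own cells, because the cells of a target form a rectangle. -/
theorem block_rank_eq_zero_or (hx : ∀ k i j, (k, i, j) ∉ D.cells → x k i j = 0)
    (α : A) (R : Set ρ) (C : Set (π ×ₗ κ)) :
    (D.block x α R C).rank = 0 ∨ ∃ p ∈ D.cells, D.tgt p.1 = α ∧ p.2.1 ∈ R ∧ colPos p ∈ C ∧
      (D.block x α R C).rank ≤ (D.block x α (Set.Ici p.2.1) (Set.Ici (colPos p))).rank := by
  classical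
  let E : Finset (π × ρ × κ) :=
    {p | p ∈ D.cells ∧ D.tgt p.1 = α ∧ p.2.1 ∈ R ∧ colPos p ∈ C}
  rcases E.eq_empty_or_nonempty with hE | hE
  · left
    have : D.block x α R C = 0 := by
      ext i c
      unfold block
      split_ifs with h
      · apply hx
        intro hmem
        have : (c.1, i, c.2) ∈ E := by simp [E, hmem, h, colPos]
        simp [hE] at this
      · rfl
    rw [this, Matrix.rank_zero]
  · right
    obtain ⟨a, ha, hamin⟩ := E.exists_min_image (fun p ↦ p.2.1) hE
    obtain ⟨b, hb, hbmin⟩ := E.exists_min_image (fun p ↦ colPos p) hE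
    simp only [E, Finset.mem_filter, Finset.mem_univ, true_and] at ha hb hamin hbmin
    obtain ⟨ka, ia, ja⟩ := a
    obtain ⟨kb, ib, jb⟩ := b
    refine ⟨(kb, ia, jb), D.rect_tgt ha.1 hb.1 (ha.2.1.trans hb.2.1.symm), hb.2.1, ha.2.2.1,
      hb.2.2.2, ?_⟩
    have h1 : D.block x α R C = D.block x α (R ∩ Set.Ici ia) (C ∩ Set.Ici (toLex (kb, jb))) := by
      ext i c
      unfold block
      by_cases h : D.tgt c.1 = α ∧ i ∈ R ∧ toLex c ∈ C
      · rw [if_pos h]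
        by_cases hm : (c.1, i, c.2) ∈ D.cells
        · rw [if_pos ⟨h.1, ⟨h.2.1, hamin (c.1, i, c.2) ⟨hm, h⟩⟩, h.2.2,
            hbmin (c.1, i, c.2) ⟨hm, h⟩⟩]
        · rw [hx _ _ _ hm, ite_self]
      · rw [if_neg h, if_neg fun h' ↦ h ⟨h'.1, h'.2.1.1, h'.2.2.1⟩]
    rw [h1]
    exact rank_block_mono Set.inter_subset_right Set.inter_subset_right

end Cond

end PageLayout

namespace PageLayout

/-! ### Deformation with a pole at the corner -/

section Deform

variable {π ρ κ A B : Type*} (D : PageLayout π ρ κ A B)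
  [LinearOrder π] [LinearOrder ρ] [LinearOrder κ]

section Def

variable {R : Type*} [CommRing R] (x : π → ρ → κ → R) (y : π × ρ × κ) (s w : R)

open Classical in
/-- The multiple of the row of `y` that is added to the row `i` on a page `k` that comes later than
the page of `y` and has the same target. -/
noncomputable def rowCoef (k : π) (i : ρ) : R :=
  if y.1 < k ∧ D.tgt k = D.tgt y.1 ∧ y.2.1 < i then s * x y.1 i y.2.2 else 0

open Classical in
/-- The multiple of the column of `y` that is added to the column `j` on a page `k` that comes later
than the page of `y` and has the same source. -/
noncomputable def colCoef (k : π) (j : κ) : R :=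
  if y.1 < k ∧ D.src k = D.src y.1 ∧ y.2.2 < j then s * x y.1 y.2.1 j else 0

open Classical in
/-- The point `x` with the value `w` at `y`, deformed so that for `w = s⁻¹` the entry `w` is a pivot
whose row and column operations, in both matrices that contain `y`, give back `x` below and right
of `y`. For `s = 0` it is `x` outside `y`. -/
noncomputable def deform : π → ρ → κ → R := fun k i j ↦
  if (k, i, j) = y then w else
    x k i j + (if k = y.1 ∧ y.2.1 < i ∧ y.2.2 < j then s * x k i y.2.2 * x k y.2.1 j else 0)
      + D.rowCoef x y s k i * x k y.2.1 j + D.colCoef x y s k j * x k i y.2.2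
      + D.rowCoef x y s k i * D.colCoef x y s k j * x k y.2.1 y.2.2

/-- The first half of the deformation: the column operations on the later pages with the same
source. -/
noncomputable def colShear : π → ρ → κ → R := fun k i j ↦
  x k i j + D.colCoef x y s k j * x k i y.2.2

variable {D x y s w}

theorem deform_transpose :
    (fun k j i ↦ D.deform x y s w k i j) =
      D.transpose.deform (fun k j i ↦ x k i j) (flip y) s w := by
  have h1 : ∀ k i, D.transpose.colCoef (fun k j i ↦ x k i j) (flip y) s k i =
      D.rowCoef x y s k i := fun k i ↦ rfl
  have h2 : ∀ k j, D.transpose.rowCoef (fun k j i ↦ x k i j) (flip y) s k j =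
      D.colCoef x y s k j := fun k j ↦ rfl
  obtain ⟨k₀, i₀, j₀⟩ := y
  ext k j i
  simp only [deform, h1, h2]
  have h3 : ((k, j, i) = flip (k₀, i₀, j₀)) ↔ (k, i, j) = (k₀, i₀, j₀) := by
    simp only [flip, Prod.mk.injEq]; tauto
  have h4 : (k = (flip (k₀, i₀, j₀)).1 ∧ (flip (k₀, i₀, j₀)).2.1 < j ∧
      (flip (k₀, i₀, j₀)).2.2 < i) ↔ (k = k₀ ∧ i₀ < i ∧ j₀ < j) := by
    simp only [flip]; tauto
  by_cases hy : (k, i, j) = (k₀, i₀, j₀)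
  · rw [if_pos hy, if_pos (h3.2 hy)]
  rw [if_neg hy, if_neg fun h ↦ hy (h3.1 h)]
  by_cases hk : k = k₀ ∧ i₀ < i ∧ j₀ < j
  · rw [if_pos hk, if_pos (h4.2 hk)]
    simp only [flip]
    ring
  · rw [if_neg hk, if_neg fun h ↦ hk (h4.1 h)]
    simp only [flip]
    ring

theorem deform_self : D.deform x y s w y.1 y.2.1 y.2.2 = w := if_pos rfl

omit [LinearOrder ρ] in
theorem colCoef_of_not_lt {k : π} (hk : ¬ y.1 < k) (j : κ) : D.colCoef x y s k j = 0 :=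
  if_neg fun h ↦ hk h.1

omit [LinearOrder κ] in
theorem rowCoef_of_not_lt {k : π} (hk : ¬ y.1 < k) (i : ρ) : D.rowCoef x y s k i = 0 :=
  if_neg fun h ↦ hk h.1

omit [LinearOrder ρ] in
theorem colShear_of_not_lt {k : π} (hk : ¬ y.1 < k) (i : ρ) (j : κ) :
    D.colShear x y s k i j = x k i j := by
  rw [colShear, colCoef_of_not_lt hk, zero_mul, add_zero]

theorem deform_of_tgt_ne {k : π} (hk : D.tgt k ≠ D.tgt y.1) (i : ρ) (j : κ) :
    D.deform x y s w k i j = D.colShear x y s k i j := by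
  have hne : k ≠ y.1 := fun h ↦ hk (h ▸ rfl)
  have h1 : D.rowCoef x y s k i = 0 := if_neg fun h ↦ hk h.2.1
  rw [deform, if_neg fun h ↦ hne (congrArg Prod.fst h), if_neg fun h ↦ hne h.1, h1, colShear]
  ring

theorem deform_of_col_le {k : π} {i : ρ} {j : κ} (hc : toLex (k, j) ≤ colPos y)
    (hne : (k, i, j) ≠ y) : D.deform x y s w k i j = x k i j := by
  rw [Prod.Lex.toLex_le_toLex] at hc
  have hk : ¬ y.1 < k := by
    rcases hc with h | h
    · exact h.not_gt
    · exact h.1.not_gt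
  have h2 : ¬ (k = y.1 ∧ y.2.1 < i ∧ y.2.2 < j) := by
    rintro ⟨h, -, hj⟩
    rcases hc with h' | h'
    · exact h'.ne h
    · exact h'.2.not_gt hj
  rw [deform, if_neg hne, if_neg h2, rowCoef_of_not_lt hk, colCoef_of_not_lt hk]
  ring

/-- Right of `y`, in the matrix of its target, the second half of the deformation adds multiples of
the row of `y` to the rows below it. -/
theorem deform_of_lt_col {k : π} (hk : D.tgt k = D.tgt y.1) {j : κ}
    (hc : colPos y < toLex (k, j)) (i : ρ) :
    D.deform x y s w k i j = D.colShear x y s k i j +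
      (if y.2.1 < i then s * x y.1 i y.2.2 else 0) * D.colShear x y s k y.2.1 j := by
  have hne : (k, i, j) ≠ y := by rintro rfl; exact lt_irrefl _ hc
  rw [Prod.Lex.toLex_lt_toLex] at hc
  rw [deform, if_neg hne]
  rcases hc with h | ⟨h, hj⟩
  · have h1 : D.rowCoef x y s k i = if y.2.1 < i then s * x y.1 i y.2.2 else 0 := by
      by_cases hi : y.2.1 < i
      · rw [rowCoef, if_pos hi, if_pos ⟨h, hk, hi⟩]
      · rw [rowCoef, if_neg hi, if_neg fun h' ↦ hi h'.2.2]
    rw [if_neg fun h' ↦ h.ne' h'.1, h1, colShear, colShear]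
    ring
  · dsimp only at h hj
    subst h
    rw [colShear_of_not_lt (lt_irrefl _), colShear_of_not_lt (lt_irrefl _),
      rowCoef_of_not_lt (lt_irrefl _), colCoef_of_not_lt (lt_irrefl _)]
    simp only [true_and, hj, and_true]
    split_ifs <;> ring

end Def

section Field

variable {L : Type*} [Field L] [Fintype π] [Fintype ρ] [Fintype κ]
variable {D} {x : π → ρ → κ → L} {y : π × ρ × κ} {S Rem : Set (π × ρ × κ)} {u : A → ℕ} {s : L}

omit [LinearOrder ρ] in
/-- Column operations do not increase the rank of a block that contains the column of `y` whenever
it contains a column that is changed. -/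
theorem rank_block_colShear_le (α : A) (R : Set ρ) {C : Set (π ×ₗ κ)}
    (hC : ∀ k j, y.1 < k → D.src k = D.src y.1 → y.2.2 < j → toLex (k, j) ∈ C →
      toLex (k, y.2.2) ∈ C) :
    (D.block (D.colShear x y s) α R C).rank ≤ (D.block x α R C).rank := by
  apply rank_le_of_cols_mem_span
  rintro ⟨k, j⟩
  by_cases hc : D.tgt k = α ∧ toLex (k, j) ∈ C
  · have : (D.block (D.colShear x y s) α R C).col (k, j) = (D.block x α R C).col (k, j) +
        D.colCoef x y s k j • (D.block x α R C).col (k, y.2.2) := by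
      ext i
      change D.block _ _ _ _ i (k, j) = D.block _ _ _ _ i (k, j) +
        D.colCoef x y s k j * D.block _ _ _ _ i (k, y.2.2)
      by_cases hi : i ∈ R
      · rw [block_apply_of_mem hc.1 hi hc.2, block_apply_of_mem hc.1 hi hc.2]
        by_cases h : y.1 < k ∧ D.src k = D.src y.1 ∧ y.2.2 < j
        · rw [block_apply_of_mem (c := (k, y.2.2)) hc.1 hi (hC k j h.1 h.2.1 h.2.2 hc.2)]
          rfl
        · have h0 : D.colCoef x y s k j = 0 := if_neg h
          rw [colShear, h0, zero_mul, zero_mul]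
      · simp only [block_apply_of_row_notMem hi, mul_zero, add_zero]
    rw [this]
    exact add_mem (Submodule.subset_span ⟨_, rfl⟩)
      (Submodule.smul_mem _ _ (Submodule.subset_span ⟨_, rfl⟩))
  · convert Submodule.zero_mem _
    ext i
    exact if_neg fun h ↦ hc ⟨h.1, h.2.2⟩

/-- On a page that the column operations change, a corner right of the column of `y` can be moved
to that column: no further chain of `S` is cut off, since `S` has no element below `y` and weakly
right of it in the matrix of its source. -/
theorem SinkCond.colShear (hc : D.IsCorner S Rem y) (hx : D.SinkCond u S Rem x) :
    D.SinkCond u S Rem (D.colShear x y s) := by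
  rintro ⟨k, a, b⟩ hp n hn
  by_cases h : y.1 < k ∧ D.src k = D.src y.1 ∧ y.2.2 < b
  · obtain ⟨hk, hsrc, hb⟩ := h
    have hmem : (k, a, y.2.2) ∈ D.cells := D.rect_src hc.mem (hc.subset hp) hsrc.symm
    have hle : D.transpose.SinkLE (flip y) (flip (k, a, y.2.2)) :=
      ⟨hsrc.symm, le_rfl, Prod.Lex.toLex_le_toLex.2 (Or.inl hk)⟩
    have hq : (k, a, y.2.2) ∈ Rem :=
      hc.mem_of_le' _ hmem hle fun h ↦ hk.ne' (congrArg Prod.fst h)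
    have hn' : HasChain D.SinkLT S n (k, a, y.2.2) := hn.imp_end fun z hz hlt ↦ by
      refine ⟨hlt.1, hlt.2.1, ?_⟩
      by_contra! hcon
      obtain ⟨-, -, hcol⟩ := hlt
      obtain ⟨kz, iz, jz⟩ := z
      simp only [colPos, Prod.Lex.toLex_le_toLex, Prod.Lex.toLex_lt_toLex] at hcon hcol
      have hkz : k = kz := by
        rcases hcon with h | h
        · rcases hcol with h' | h'
          · exact absurd h' h.not_gt
          · exact h'.1.symm
        · exact h.1
      subst hkz
      have hjz : y.2.2 ≤ jz := by
        rcases hcon with h | h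
        · exact absurd h (lt_irrefl _)
        · exact h.2
      exact hc.not_ge' _ hz ⟨hsrc.symm, hjz, Prod.Lex.toLex_le_toLex.2 (Or.inl hk)⟩
    have h2 := hx _ hq n hn'
    refine le_trans (Nat.add_le_add_right ((rank_block_mono le_rfl ?_).trans
      (rank_block_colShear_le _ _ ?_)) n) h2
    · exact Set.Ici_subset_Ici.2 (Prod.Lex.toLex_le_toLex.2 (Or.inr ⟨rfl, hb.le⟩))
    · intro k' j' _ _ hj' hmem'
      simp only [Set.mem_Ici, colPos, Prod.Lex.toLex_le_toLex] at hmem' ⊢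
      exact hmem'.imp_right fun h ↦ ⟨h.1, le_rfl⟩
  · refine le_trans (Nat.add_le_add_right (rank_block_colShear_le _ _ ?_) n) (hx _ hp n hn)
    intro k' j' hk' hsrc' hj' hmem'
    simp only [Set.mem_Ici, colPos, Prod.Lex.toLex_le_toLex] at hmem' ⊢
    rcases hmem' with h' | ⟨h', h''⟩
    · exact Or.inl h'
    · subst h'
      exact Or.inr ⟨rfl, not_lt.1 fun hb ↦ h ⟨hk', hsrc', hb⟩⟩

end Field

end Deform

end PageLayout

namespace PageLayout

/-! ### Rank conditions at the deformed point -/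

section DeformCond

variable {π ρ κ A B : Type*} {D : PageLayout π ρ κ A B}
  [LinearOrder π] [LinearOrder ρ] [LinearOrder κ]
variable {L : Type*} [Field L] [Fintype π] [Fintype ρ] [Fintype κ]
variable {x : π → ρ → κ → L} {y : π × ρ × κ} {S Rem : Set (π × ρ × κ)} {u : A → ℕ} {s : L}

omit [Fintype ρ] in
/-- The deformed block at `y` differs by a matrix of rank one from the block strictly below and
right of `y`, because its entry `s⁻¹` is a pivot. -/
theorem rank_block_deform_self_le (hs : s ≠ 0) :
    (D.block (D.deform x y s s⁻¹) (D.tgt y.1) (Set.Ici y.2.1) (Set.Ici (colPos y))).rank ≤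
      (D.block (D.colShear x y s) (D.tgt y.1) (Set.Ioi y.2.1) (Set.Ioi (colPos y))).rank + 1 := by
  classical
  let v : ρ → L := fun i ↦ if y.2.1 < i then s * x y.1 i y.2.2 else if i = y.2.1 then 1 else 0
  let w : π × κ → L := fun c ↦ if c = (y.1, y.2.2) then s⁻¹ else
    if D.tgt c.1 = D.tgt y.1 ∧ colPos y < toLex c then D.colShear x y s c.1 y.2.1 c.2 else 0
  refine le_trans (le_of_eq (congrArg Matrix.rank ?_)) (rank_add_vecMulVec_le _ v w)
  ext i ⟨k, j⟩
  rw [Matrix.add_apply, Matrix.vecMulVec_apply]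
  by_cases hk : D.tgt k = D.tgt y.1
  swap
  · have hw : w (k, j) = 0 := by
      have : (k, j) ≠ (y.1, y.2.2) := fun h ↦ hk (congrArg (fun c : π × κ ↦ D.tgt c.1) h)
      simp [w, this, hk]
    rw [block_apply_of_tgt_ne hk, block_apply_of_tgt_ne hk, hw, mul_zero, add_zero]
  rcases lt_trichotomy (colPos y) (toLex (k, j)) with hc | hc | hc
  · -- columns to the right of `y`
    have hw : w (k, j) = D.colShear x y s k y.2.1 j := by
      have : (k, j) ≠ (y.1, y.2.2) := by
        intro h
        rw [h] at hc
        exact lt_irrefl _ hc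
      simp only [w, if_neg this]
      rw [if_pos ⟨hk, hc⟩]
    rw [hw]
    rcases lt_trichotomy y.2.1 i with hi | hi | hi
    · rw [block_apply_of_mem hk (Set.mem_Ici.2 hi.le) (Set.mem_Ici.2 hc.le),
        block_apply_of_mem hk (Set.mem_Ioi.2 hi) (Set.mem_Ioi.2 hc), deform_of_lt_col hk hc]
      simp only [v, if_pos hi]
    · subst hi
      rw [block_apply_of_mem hk Set.self_mem_Ici (Set.mem_Ici.2 hc.le),
        block_apply_of_row_notMem Set.self_notMem_Ioi, deform_of_lt_col hk hc]
      simp [v]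
    · rw [block_apply_of_row_notMem (Set.notMem_Ici.2 hi),
        block_apply_of_row_notMem (Set.notMem_Ioi.2 hi.le)]
      simp [v, hi.not_gt, hi.ne]
  · -- the column of `y`
    have hkj : (k, j) = (y.1, y.2.2) := (toLex.injective hc).symm
    have hw : w (k, j) = s⁻¹ := if_pos hkj
    have hk' : k = y.1 := congrArg Prod.fst hkj
    have hj' : j = y.2.2 := congrArg Prod.snd hkj
    have hc' : toLex (k, j) ∉ Set.Ioi (colPos y) := fun h ↦ (ne_of_lt h) hc
    rw [hw, block_apply_of_col_notMem hc', zero_add]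
    rcases lt_trichotomy y.2.1 i with hi | hi | hi
    · rw [block_apply_of_mem hk (Set.mem_Ici.2 hi.le) (Set.mem_Ici.2 hc.le), deform_of_col_le hc.ge]
      · simp only [v, if_pos hi, hk', hj']
        field_simp
      · rintro rfl
        exact lt_irrefl _ hi
    · subst hi
      rw [block_apply_of_mem hk Set.self_mem_Ici (Set.mem_Ici.2 hc.le)]
      subst hk' hj'
      rw [deform_self]
      simp [v]
    · rw [block_apply_of_row_notMem (Set.notMem_Ici.2 hi)]
      simp [v, hi.not_gt, hi.ne]
  · -- columns to the left of `y`
    have hw : w (k, j) = 0 := by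
      have : (k, j) ≠ (y.1, y.2.2) := by
        intro h
        rw [h] at hc
        exact lt_irrefl _ hc
      simp only [w, if_neg this]
      rw [if_neg fun h ↦ hc.not_gt h.2]
    rw [block_apply_of_col_notMem (Set.notMem_Ici.2 hc),
      block_apply_of_col_notMem (Set.notMem_Ioi.2 hc.le), hw]
    ring

/-- A block that starts in the row of `y` or above, and right of `y`, changes by row operations. -/
theorem rank_block_deform_le_of_row_le {a : ρ} {q : π ×ₗ κ} (ha : a ≤ y.2.1) (hq : colPos y < q)
    (w : L) :
    (D.block (D.deform x y s w) (D.tgt y.1) (Set.Ici a) (Set.Ici q)).rank ≤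
      (D.block (D.colShear x y s) (D.tgt y.1) (Set.Ici a) (Set.Ici q)).rank := by
  apply rank_le_of_rows_mem_span
  intro i
  by_cases hi : a ≤ i
  · have : (D.block (D.deform x y s w) (D.tgt y.1) (Set.Ici a) (Set.Ici q)).row i =
        (D.block (D.colShear x y s) (D.tgt y.1) (Set.Ici a) (Set.Ici q)).row i +
        (if y.2.1 < i then s * x y.1 i y.2.2 else 0) •
          (D.block (D.colShear x y s) (D.tgt y.1) (Set.Ici a) (Set.Ici q)).row y.2.1 := by
      ext ⟨k, j⟩
      change D.block (D.deform x y s w) _ _ _ i (k, j) = D.block (D.colShear x y s) _ _ _ i (k, j) +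
        _ * D.block (D.colShear x y s) _ _ _ y.2.1 (k, j)
      by_cases h : D.tgt k = D.tgt y.1 ∧ q ≤ toLex (k, j)
      · rw [block_apply_of_mem h.1 (Set.mem_Ici.2 hi) (Set.mem_Ici.2 h.2),
          block_apply_of_mem h.1 (Set.mem_Ici.2 hi) (Set.mem_Ici.2 h.2),
          block_apply_of_mem h.1 (Set.mem_Ici.2 ha) (Set.mem_Ici.2 h.2), deform_of_lt_col h.1 (hq.trans_le h.2)]
      · have h0 : ∀ (z : π → ρ → κ → L) i, D.block z (D.tgt y.1) (Set.Ici a) (Set.Ici q) i (k, j)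
            = 0 := fun z i ↦ if_neg fun h' ↦ h ⟨h'.1, h'.2.2⟩
        simp only [h0, mul_zero, add_zero]
    rw [this]
    exact add_mem (Submodule.subset_span ⟨_, rfl⟩)
      (Submodule.smul_mem _ _ (Submodule.subset_span ⟨_, rfl⟩))
  · convert Submodule.zero_mem _
    ext c
    exact block_apply_of_row_notMem (Set.notMem_Ici.2 (not_le.1 hi))

/-- A block that starts below the row of `y`, and in the column of `y` or left of it, changes by
column operations. -/
theorem rank_block_deform_le_of_col_le {a : ρ} {q : π ×ₗ κ} (ha : y.2.1 < a) (hq : q ≤ colPos y)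
    (w : L) :
    (D.block (D.deform x y s w) (D.tgt y.1) (Set.Ici a) (Set.Ici q)).rank ≤
      (D.block (D.colShear x y s) (D.tgt y.1) (Set.Ici a) (Set.Ici q)).rank := by
  classical
  apply rank_le_of_cols_mem_span
  rintro ⟨k, j⟩
  by_cases hc : D.tgt k = D.tgt y.1 ∧ q ≤ toLex (k, j)
  · have : (D.block (D.deform x y s w) (D.tgt y.1) (Set.Ici a) (Set.Ici q)).col (k, j) =
        (D.block (D.colShear x y s) (D.tgt y.1) (Set.Ici a) (Set.Ici q)).col (k, j) +
        (if colPos y < toLex (k, j) then s * D.colShear x y s k y.2.1 j else 0) •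
          (D.block (D.colShear x y s) (D.tgt y.1) (Set.Ici a) (Set.Ici q)).col (y.1, y.2.2) := by
      ext i
      change D.block (D.deform x y s w) _ _ _ i (k, j) = D.block (D.colShear x y s) _ _ _ i (k, j) +
        _ * D.block (D.colShear x y s) _ _ _ i (y.1, y.2.2)
      by_cases hi : a ≤ i
      · rw [block_apply_of_mem hc.1 (Set.mem_Ici.2 hi) (Set.mem_Ici.2 hc.2),
          block_apply_of_mem hc.1 (Set.mem_Ici.2 hi) (Set.mem_Ici.2 hc.2),
          block_apply_of_mem rfl (Set.mem_Ici.2 hi) (Set.mem_Ici.2 hq)]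
        have hi' : y.2.1 < i := ha.trans_le hi
        split_ifs with h
        · rw [deform_of_lt_col hc.1 h, if_pos hi', colShear_of_not_lt (lt_irrefl y.1)]
          ring
        · have hne : (k, i, j) ≠ y := by rintro rfl; exact lt_irrefl _ hi'
          have hk : ¬ y.1 < k := fun hk ↦ h (Prod.Lex.toLex_lt_toLex.2 (Or.inl hk))
          rw [deform_of_col_le (not_lt.1 h) hne, colShear_of_not_lt hk, zero_mul, add_zero]
      · have hi' : i ∉ Set.Ici a := hi
        simp only [block_apply_of_row_notMem hi', mul_zero, add_zero]
    rw [this]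
    exact add_mem (Submodule.subset_span ⟨_, rfl⟩)
      (Submodule.smul_mem _ _ (Submodule.subset_span ⟨_, rfl⟩))
  · convert Submodule.zero_mem _
    ext i
    exact if_neg fun h ↦ hc ⟨h.1, h.2.2⟩

/-- The deformed point satisfies the rank conditions at `y` as well, provided that the block strictly
below and right of `y` leaves room for the pivot. -/
theorem SinkCond.deform (hc : D.IsCorner S Rem y) (hx : D.SinkCond u S Rem x)
    (hB : ∀ n, HasChain D.SinkLT S n y →
      (D.block x (D.tgt y.1) (Set.Ioi y.2.1) (Set.Ioi (colPos y))).rank + n + 1 ≤ u (D.tgt y.1))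
    (hs : s ≠ 0) : D.SinkCond u S (insert y Rem) (D.deform x y s s⁻¹) := by
  have hx' := hx.colShear (s := s) hc
  have hy : ∀ n, HasChain D.SinkLT S n y → (D.block (D.deform x y s s⁻¹) (D.tgt y.1)
      (Set.Ici y.2.1) (Set.Ici (colPos y))).rank + n ≤ u (D.tgt y.1) := by
    intro n hn
    have h1 := rank_block_deform_self_le (D := D) (x := x) (y := y) hs
    have h2 : (D.block (D.colShear x y s) (D.tgt y.1) (Set.Ioi y.2.1) (Set.Ioi (colPos y))).rank ≤
        (D.block x (D.tgt y.1) (Set.Ioi y.2.1) (Set.Ioi (colPos y))).rank := by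
      refine rank_block_colShear_le _ _ fun k j hk _ _ _ ↦ ?_
      exact Prod.Lex.toLex_lt_toLex.2 (Or.inl hk)
    have h3 := hB n hn
    omega
  rintro ⟨k, a, b⟩ (rfl | hp) n hn
  · exact hy n hn
  by_cases hk : D.tgt k = D.tgt y.1
  swap
  · rw [block_congr (x' := D.colShear x y s)]
    · exact hx' _ hp n hn
    · intro k' i j hk' _ _
      exact deform_of_tgt_ne (hk'.trans_ne hk) i j
  have hcell := hc.subset hp
  dsimp only [colPos]
  rw [hk]
  rcases le_or_gt a y.2.1 with ha | ha
  · have hq : colPos y < toLex (k, b) := by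
      by_contra! h
      exact hc.not_le _ hp ⟨hk, ha, h⟩
    refine le_trans (Nat.add_le_add_right (rank_block_deform_le_of_row_le ha hq _) n) ?_
    rw [← hk]
    exact hx' _ hp n hn
  rcases le_or_gt (toLex (k, b)) (colPos y) with hq | hq
  · refine le_trans (Nat.add_le_add_right (rank_block_deform_le_of_col_le ha hq _) n) ?_
    rw [← hk]
    exact hx' _ hp n hn
  -- The corner is strictly below and right of `y`. The last element of the chain is not, so the
  -- corner can be moved to the row or to the column of `y` without cutting off the chain.
  have key : HasChain D.SinkLT S n (k, y.2.1, b) ∨ HasChain D.SinkLT S n (y.1, a, y.2.2) := by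
    cases hn with
    | zero => exact Or.inl (.zero _)
    | @succ n z _ hz hlt h =>
      obtain ⟨h1, h2, h3⟩ := hlt
      rcases lt_or_ge z.2.1 y.2.1 with hr | hr
      · exact Or.inl (.succ hz ⟨h1, hr, h3⟩ h)
      · rcases lt_or_ge (colPos z) (colPos y) with hl | hl
        · exact Or.inr (.succ hz ⟨h1.trans hk, h2, hl⟩ h)
        · exact absurd ⟨(h1.trans hk).symm, hr, hl⟩ (hc.not_ge z hz)
  rcases key with hn' | hn'
  · have hmem : (k, y.2.1, b) ∈ Rem := by
      refine hc.mem_of_le _ (D.rect_tgt hc.mem hcell hk.symm) ⟨hk.symm, le_rfl, hq.le⟩ fun h ↦ ?_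
      exact hq.ne' (congrArg colPos h)
    have h1 := hx' _ hmem n hn'
    have h2 := rank_block_deform_le_of_row_le (D := D) (x := x) (s := s) le_rfl hq s⁻¹
    have h3 := rank_block_mono (D := D) (x := D.deform x y s s⁻¹) (α := D.tgt y.1)
      (Set.Ici_subset_Ici.2 ha.le) (subset_refl (Set.Ici (toLex (k, b))))
    simp only [colPos, hk] at h1
    omega
  · have hmem : (y.1, a, y.2.2) ∈ Rem := by
      refine hc.mem_of_le _ (D.rect_tgt hcell hc.mem hk) ⟨rfl, ha.le, le_rfl⟩ fun h ↦ ?_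
      exact ha.ne' (congrArg (fun p ↦ p.2.1) h)
    have h1 := hx' _ hmem n hn'
    have h2 := rank_block_deform_le_of_col_le (D := D) (x := x) (s := s) ha le_rfl s⁻¹
    have h3 := rank_block_mono (D := D) (x := D.deform x y s s⁻¹) (α := D.tgt y.1)
      (subset_refl (Set.Ici a)) (Set.Ici_subset_Ici.2 hq.le)
    simp only [colPos] at h1 h2 h3 ⊢
    omega

end DeformCond

end PageLayout

namespace PageLayout

/-! ### Filling in the corner -/

section Fill

variable {π ρ κ A B : Type*} {D : PageLayout π ρ κ A B}

open Classical in
/-- The point `x` with its value at the cell `y` replaced by `w`. -/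
noncomputable def fill {L : Type*} (x : π → ρ → κ → L) (y : π × ρ × κ) (w : L) : π → ρ → κ → L :=
  fun k i j ↦ if (k, i, j) = y then w else x k i j

theorem fill_self {L : Type*} (x : π → ρ → κ → L) (y : π × ρ × κ) (w : L) :
    fill x y w y.1 y.2.1 y.2.2 = w := if_pos rfl

theorem fill_of_ne {L : Type*} (x : π → ρ → κ → L) {y : π × ρ × κ} (w : L) {k : π} {i : ρ} {j : κ}
    (h : (k, i, j) ≠ y) : fill x y w k i j = x k i j := if_neg h

theorem fill_transpose {L : Type*} (x : π → ρ → κ → L) (y : π × ρ × κ) (w : L) :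
    (fun k j i ↦ fill x y w k i j) = fill (fun k j i ↦ x k i j) (flip y) w := by
  ext k j i
  by_cases h : (k, i, j) = y
  · subst h
    exact (fill_self x (k, i, j) w).trans (fill_self (fun k j i ↦ x k i j) (k, j, i) w).symm
  · rw [fill_of_ne _ _ h, fill_of_ne]
    exact fun h' ↦ h (flip_injective h')

variable [LinearOrder π] [LinearOrder ρ] [LinearOrder κ]
variable {L : Type*} [Field L] [Fintype π] [Fintype ρ] [Fintype κ]
variable {x : π → ρ → κ → L} {y : π × ρ × κ} {S Rem : Set (π × ρ × κ)} {u : A → ℕ} {w : L}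

omit [Fintype ρ] in
theorem SinkCond.mono {T : Set (π × ρ × κ)} (h : S ⊆ T) (hx : D.SinkCond u T Rem x) :
    D.SinkCond u S Rem x :=
  fun p hp n hn ↦ hx p hp n (hn.mono h)

/-- A block below and right of `y` that does not contain `y` is controlled by the remaining
corners. -/
theorem SinkCond.rank_block_add_le (hsupp : ∀ k i j, (k, i, j) ∉ D.cells → x k i j = 0)
    (hc : D.IsCorner S Rem y) (hx : D.SinkCond u S Rem x) {R : Set ρ} {C : Set (π ×ₗ κ)}
    (hR : R ⊆ Set.Ici y.2.1) (hC : C ⊆ Set.Ici (colPos y)) (hy : y.2.1 ∉ R ∨ colPos y ∉ C)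
    {n : ℕ} (hn : HasChain D.SinkLT S n y) (hnu : n ≤ u (D.tgt y.1)) :
    (D.block x (D.tgt y.1) R C).rank + n ≤ u (D.tgt y.1) := by
  rcases block_rank_eq_zero_or hsupp (D.tgt y.1) R C with h | ⟨p, hp, hα, hpR, hpC, hle⟩
  · rwa [h, zero_add]
  · have hpy : p ≠ y := by
      rintro rfl
      exact hy.elim (fun h ↦ h hpR) (fun h ↦ h hpC)
    have h1 := hx p (hc.mem_of_le p hp ⟨hα.symm, hR hpR, hC hpC⟩ hpy) n
      (hn.imp_end fun z _ hz ↦ ⟨hz.1.trans hα.symm, hz.2.1.trans_le (hR hpR),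
        hz.2.2.trans_le (hC hpC)⟩)
    rw [hα] at h1
    exact (Nat.add_le_add_right hle n).trans h1

/-- When `y` is counted among the elements of chains, there is room for one more pivot in the block
strictly below and right of `y`. -/
theorem SinkCond.rank_block_add_one_le (hsupp : ∀ k i j, (k, i, j) ∉ D.cells → x k i j = 0)
    (hc : D.IsCorner S Rem y) (hx : D.SinkCond u (insert y S) Rem x)
    {n : ℕ} (hn : HasChain D.SinkLT S n y) (hnu : n + 1 ≤ u (D.tgt y.1)) :
    (D.block x (D.tgt y.1) (Set.Ioi y.2.1) (Set.Ioi (colPos y))).rank + n + 1 ≤ u (D.tgt y.1) := by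
  rcases block_rank_eq_zero_or hsupp (D.tgt y.1) (Set.Ioi y.2.1) (Set.Ioi (colPos y)) with
    h | ⟨p, hp, hα, hpR, hpC, hle⟩
  · rwa [h, zero_add]
  · rw [Set.mem_Ioi] at hpR hpC
    have hpy : p ≠ y := by
      rintro rfl
      exact lt_irrefl _ hpR
    have h1 := hx p (hc.mem_of_le p hp ⟨hα.symm, hpR.le, hpC.le⟩ hpy) (n + 1)
      (.succ (Set.mem_insert _ _) ⟨hα.symm, hpR, hpC⟩ (hn.mono (Set.subset_insert _ _)))
    rw [hα] at h1
    omega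

omit [Fintype ρ] in
theorem SinkCond.fill (hc : D.IsCorner S Rem y) (hx : D.SinkCond u S Rem x)
    (hy : ∀ n, HasChain D.SinkLT S n y → (D.block (PageLayout.fill x y w) (D.tgt y.1)
      (Set.Ici y.2.1) (Set.Ici (colPos y))).rank + n ≤ u (D.tgt y.1)) :
    D.SinkCond u S (insert y Rem) (PageLayout.fill x y w) := by
  rintro p (rfl | hp) n hn
  · exact hy n hn
  · rw [block_congr (x' := x)]
    · exact hx p hp n hn
    · intro k i j hk hi hj
      refine fill_of_ne _ _ ?_
      rintro rfl
      exact hc.not_le p hp ⟨hk.symm, hi, hj⟩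

/-- If the block strictly below and right of `y` has the maximal rank that the conditions allow,
then the row of `y`, right of `y`, is a combination of the rows below it. -/
theorem exists_row_combination
    (h : (D.block x (D.tgt y.1) (Set.Ici y.2.1) (Set.Ioi (colPos y))).rank ≤
      (D.block x (D.tgt y.1) (Set.Ioi y.2.1) (Set.Ioi (colPos y))).rank) :
    ∃ l : ρ → L, ∀ k j, D.tgt k = D.tgt y.1 → colPos y < toLex (k, j) →
      x k y.2.1 j = ∑ i, if y.2.1 < i then l i * x k i j else 0 := by
  have h1 := row_mem_span_of_rank_le
    (block_row_mem_span (D := D) (x := x) (α := D.tgt y.1) (C := Set.Ioi (colPos y))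
      Set.Ioi_subset_Ici_self) h y.2.1
  obtain ⟨l, hl⟩ := (Submodule.mem_span_range_iff_exists_fun L).1 h1
  refine ⟨l, fun k j hk hj ↦ ?_⟩
  have h2 := congrFun hl (k, j)
  rw [Finset.sum_apply] at h2
  change (∑ i, l i * D.block x _ _ _ i (k, j)) = D.block x _ _ _ y.2.1 (k, j) at h2
  rw [block_apply_of_mem hk Set.self_mem_Ici (Set.mem_Ioi.2 hj)] at h2
  rw [← h2]
  refine Finset.sum_congr rfl fun i _ ↦ ?_
  split_ifs with hi
  · rw [block_apply_of_mem hk (Set.mem_Ioi.2 hi) (Set.mem_Ioi.2 hj)]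
  · rw [block_apply_of_row_notMem (Set.notMem_Ioi.2 (not_lt.1 hi)), mul_zero]

theorem rank_block_fill_le_of_row {l : ρ → L}
    (hl : ∀ k j, D.tgt k = D.tgt y.1 → colPos y < toLex (k, j) →
      x k y.2.1 j = ∑ i, if y.2.1 < i then l i * x k i j else 0)
    (hw : w = ∑ i, if y.2.1 < i then l i * x y.1 i y.2.2 else 0) :
    (D.block (PageLayout.fill x y w) (D.tgt y.1) (Set.Ici y.2.1) (Set.Ici (colPos y))).rank ≤
      (D.block x (D.tgt y.1) (Set.Ioi y.2.1) (Set.Ici (colPos y))).rank := by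
  apply rank_le_of_rows_mem_span
  intro i
  rcases lt_trichotomy y.2.1 i with hi | hi | hi
  · refine Submodule.subset_span ⟨i, ?_⟩
    ext ⟨k, j⟩
    change D.block x _ _ _ i (k, j) = D.block (PageLayout.fill x y w) _ _ _ i (k, j)
    by_cases h : D.tgt k = D.tgt y.1 ∧ colPos y ≤ toLex (k, j)
    · rw [block_apply_of_mem h.1 (Set.mem_Ioi.2 hi) (Set.mem_Ici.2 h.2),
        block_apply_of_mem h.1 (Set.mem_Ici.2 hi.le) (Set.mem_Ici.2 h.2), fill_of_ne]
      rintro rfl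
      exact lt_irrefl _ hi
    · exact (if_neg fun h' ↦ h ⟨h'.1, h'.2.2⟩).trans (if_neg fun h' ↦ h ⟨h'.1, h'.2.2⟩).symm
  · subst hi
    refine (Submodule.mem_span_range_iff_exists_fun L).2 ⟨l, ?_⟩
    ext ⟨k, j⟩
    rw [Finset.sum_apply]
    change (∑ i, l i * D.block x _ _ _ i (k, j)) =
      D.block (PageLayout.fill x y w) _ _ _ y.2.1 (k, j)
    by_cases h : D.tgt k = D.tgt y.1 ∧ colPos y ≤ toLex (k, j)
    · rw [block_apply_of_mem h.1 Set.self_mem_Ici (Set.mem_Ici.2 h.2)]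
      have hval : PageLayout.fill x y w k y.2.1 j =
          ∑ i, if y.2.1 < i then l i * x k i j else 0 := by
        rcases h.2.lt_or_eq with hlt | heq
        · rw [fill_of_ne, hl k j h.1 hlt]
          intro h'
          exact hlt.ne' (congrArg colPos h')
        · have hkj : (y.1, y.2.2) = (k, j) := toLex.injective heq
          obtain ⟨rfl, rfl⟩ := Prod.mk.inj hkj
          rw [fill_self, hw]
      rw [hval]
      refine Finset.sum_congr rfl fun i _ ↦ ?_
      split_ifs with hi
      · rw [block_apply_of_mem h.1 (Set.mem_Ioi.2 hi) (Set.mem_Ici.2 h.2)]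
      · rw [block_apply_of_row_notMem (Set.notMem_Ioi.2 (not_lt.1 hi)), mul_zero]
    · have h0 : ∀ (z : π → ρ → κ → L) R i,
          D.block z (D.tgt y.1) R (Set.Ici (colPos y)) i (k, j) = 0 :=
        fun z R i ↦ if_neg fun h' ↦ h ⟨h'.1, h'.2.2⟩
      simp only [h0, mul_zero, Finset.sum_const_zero]
  · convert Submodule.zero_mem _
    ext c
    exact block_apply_of_row_notMem (Set.notMem_Ici.2 hi)

theorem rank_block_fill_le_of_col {l : κ → L}
    (hl : ∀ i, y.2.1 < i → x y.1 i y.2.2 = ∑ j, if y.2.2 < j then l j * x y.1 i j else 0)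
    (hw : w = ∑ j, if y.2.2 < j then l j * x y.1 y.2.1 j else 0) :
    (D.block (PageLayout.fill x y w) (D.tgt y.1) (Set.Ici y.2.1) (Set.Ici (colPos y))).rank ≤
      (D.block x (D.tgt y.1) (Set.Ici y.2.1) (Set.Ioi (colPos y))).rank := by
  classical
  apply rank_le_of_cols_mem_span
  rintro ⟨k, j⟩
  rcases lt_trichotomy (colPos y) (toLex (k, j)) with hc | hc | hc
  · refine Submodule.subset_span ⟨(k, j), ?_⟩
    ext i
    change D.block x _ _ _ i (k, j) = D.block (PageLayout.fill x y w) _ _ _ i (k, j)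
    by_cases h : D.tgt k = D.tgt y.1 ∧ y.2.1 ≤ i
    · rw [block_apply_of_mem h.1 (Set.mem_Ici.2 h.2) (Set.mem_Ioi.2 hc),
        block_apply_of_mem h.1 (Set.mem_Ici.2 h.2) (Set.mem_Ici.2 hc.le), fill_of_ne]
      rintro rfl
      exact lt_irrefl _ hc
    · exact (if_neg fun h' ↦ h ⟨h'.1, h'.2.1⟩).trans (if_neg fun h' ↦ h ⟨h'.1, h'.2.1⟩).symm
  · have hkj : (y.1, y.2.2) = (k, j) := toLex.injective hc
    obtain ⟨rfl, rfl⟩ := Prod.mk.inj hkj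
    have hsum : (D.block (PageLayout.fill x y w) (D.tgt y.1) (Set.Ici y.2.1)
        (Set.Ici (colPos y))).col (y.1, y.2.2) = ∑ j, (if y.2.2 < j then l j else 0) •
          (D.block x (D.tgt y.1) (Set.Ici y.2.1) (Set.Ioi (colPos y))).col (y.1, j) := by
      ext i
      rw [Finset.sum_apply]
      change D.block (PageLayout.fill x y w) _ _ _ i (y.1, y.2.2) =
        ∑ j, (if y.2.2 < j then l j else 0) * D.block x _ _ _ i (y.1, j)
      by_cases hi : y.2.1 ≤ i
      · have hval : PageLayout.fill x y w y.1 i y.2.2 =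
            ∑ j, if y.2.2 < j then l j * x y.1 i j else 0 := by
          rcases hi.lt_or_eq with hlt | rfl
          · rw [fill_of_ne, hl i hlt]
            rintro h'
            exact hlt.ne' (congrArg (fun p ↦ p.2.1) h')
          · rw [fill_self, hw]
        rw [block_apply_of_mem (c := (y.1, y.2.2)) rfl (Set.mem_Ici.2 hi) Set.self_mem_Ici]
        refine hval.trans (Finset.sum_congr rfl fun j _ ↦ ?_)
        split_ifs with hj
        · have hj' : colPos y < toLex (y.1, j) := Prod.Lex.toLex_lt_toLex.2 (Or.inr ⟨rfl, hj⟩)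
          rw [block_apply_of_mem (c := (y.1, j)) rfl (Set.mem_Ici.2 hi) (Set.mem_Ioi.2 hj')]
        · rw [zero_mul]
      · have hi' : i ∉ Set.Ici y.2.1 := hi
        simp only [block_apply_of_row_notMem hi', mul_zero, Finset.sum_const_zero]
    rw [hsum]
    exact Submodule.sum_mem _ fun j _ ↦ Submodule.smul_mem _ _ (Submodule.subset_span ⟨_, rfl⟩)
  · convert Submodule.zero_mem _
    ext i
    exact block_apply_of_col_notMem (Set.notMem_Ici.2 hc)

variable {v : B → ℕ}

/-- If the block strictly below and right of `y` in the matrix of the target has maximal rank, then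
the entry at `y` is determined by the row combination found there. The same combination shows that
the conditions at `y` in the matrix of the source hold as well, since the row of `y` in that matrix
is the part of the combined rows that lies on the page of `y`. -/
theorem exists_fill (hsupp : ∀ k i j, (k, i, j) ∉ D.cells → x k i j = 0)
    (hc : D.IsCorner S Rem y) (hx : D.SinkCond u S Rem x)
    (hx' : D.transpose.SinkCond v (flip '' S) (flip '' Rem) fun k j i ↦ x k i j)
    (hu : ∀ n, HasChain D.SinkLT S n y → n ≤ u (D.tgt y.1))
    (hv : ∀ n, HasChain D.transpose.SinkLT (flip '' S) n (flip y) → n ≤ v (D.src y.1))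
    {n : ℕ} (hn : HasChain D.SinkLT S n y) (hr : u (D.tgt y.1) <
      (D.block x (D.tgt y.1) (Set.Ioi y.2.1) (Set.Ioi (colPos y))).rank + n + 1) :
    ∃ w, D.SinkCond u S (insert y Rem) (PageLayout.fill x y w) ∧
      D.transpose.SinkCond v (flip '' S) (flip '' insert y Rem)
        fun k j i ↦ PageLayout.fill x y w k i j := by
  have h1 := hx.rank_block_add_le hsupp hc subset_rfl Set.Ioi_subset_Ici_self
    (Or.inr Set.self_notMem_Ioi) hn (hu n hn)
  obtain ⟨l, hl⟩ := exists_row_combination (D := D) (x := x) (y := y) (by omega)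
  refine ⟨∑ i, if y.2.1 < i then l i * x y.1 i y.2.2 else 0, ?_, ?_⟩
  · refine hx.fill hc fun n' hn' ↦ ?_
    have h2 := hx.rank_block_add_le hsupp hc Set.Ioi_subset_Ici_self subset_rfl
      (Or.inl Set.self_notMem_Ioi) hn' (hu n' hn')
    exact (Nat.add_le_add_right (rank_block_fill_le_of_row hl rfl) _).trans h2
  · rw [fill_transpose, Set.image_insert_eq]
    refine SinkCond.fill hc.transpose hx' fun n' hn' ↦ ?_
    have h2 := SinkCond.rank_block_add_le (D := D.transpose) (fun k j i h ↦ hsupp k i j h)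
      hc.transpose hx' subset_rfl Set.Ioi_subset_Ici_self (Or.inr Set.self_notMem_Ioi) hn'
      (hv n' hn')
    refine (Nat.add_le_add_right (rank_block_fill_le_of_col (l := l) ?_ rfl) _).trans h2
    intro j hj
    exact hl y.1 j rfl (Prod.Lex.toLex_lt_toLex.2 (Or.inr ⟨rfl, hj⟩))

/-- A point that satisfies the conditions after the removal of `y` either can be changed at `y` so
that the conditions at `y` hold too, or its deformations with a pole at `y` satisfy them. -/
theorem exists_fill_or_deform (hsupp : ∀ k i j, (k, i, j) ∉ D.cells → x k i j = 0)
    (hc : D.IsCorner S Rem y) (hx : D.SinkCond u S Rem x)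
    (hx' : D.transpose.SinkCond v (flip '' S) (flip '' Rem) fun k j i ↦ x k i j)
    (hu : ∀ n, HasChain D.SinkLT S n y → n ≤ u (D.tgt y.1))
    (hv : ∀ n, HasChain D.transpose.SinkLT (flip '' S) n (flip y) → n ≤ v (D.src y.1)) :
    (∃ w, D.SinkCond u S (insert y Rem) (PageLayout.fill x y w) ∧
      D.transpose.SinkCond v (flip '' S) (flip '' insert y Rem)
        fun k j i ↦ PageLayout.fill x y w k i j) ∨
    ∀ s : L, s ≠ 0 → D.SinkCond u S (insert y Rem) (D.deform x y s s⁻¹) ∧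
      D.transpose.SinkCond v (flip '' S) (flip '' insert y Rem)
        fun k j i ↦ D.deform x y s s⁻¹ k i j := by
  by_cases h : ∃ n, HasChain D.SinkLT S n y ∧ u (D.tgt y.1) <
      (D.block x (D.tgt y.1) (Set.Ioi y.2.1) (Set.Ioi (colPos y))).rank + n + 1
  · obtain ⟨n, hn, hr⟩ := h
    exact Or.inl (exists_fill hsupp hc hx hx' hu hv hn hr)
  by_cases h' : ∃ n, HasChain D.transpose.SinkLT (flip '' S) n (flip y) ∧ v (D.src y.1) <
      (D.transpose.block (fun k j i ↦ x k i j) (D.src y.1) (Set.Ioi y.2.2)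
        (Set.Ioi (colPos (flip y)))).rank + n + 1
  · obtain ⟨n, hn, hr⟩ := h'
    have himg : flip '' (flip '' S) = S := by simp [Set.image_image]
    have himg' : flip '' (flip '' Rem) = Rem := by simp [Set.image_image]
    obtain ⟨w, hw, hw'⟩ := exists_fill (D := D.transpose) (v := u)
      (fun k j i h ↦ hsupp k i j h) hc.transpose hx' (by rw [himg, himg']; exact hx) hv
      (by rw [himg]; exact hu) hn hr
    refine Or.inl ⟨w, ?_, ?_⟩
    · rw [Set.image_insert_eq, himg, himg', fill_transpose] at hw'
      exact hw'
    · rw [Set.image_insert_eq, fill_transpose]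
      exact hw
  push Not at h h'
  refine Or.inr fun s hs ↦ ⟨hx.deform hc h hs, ?_⟩
  rw [deform_transpose, Set.image_insert_eq]
  exact SinkCond.deform hc.transpose hx' h' hs

end Fill

end PageLayout

open MvPolynomial
open scoped MonomialOrder

/-! ### The top coefficient with respect to the largest variable -/

section TopCoeff

variable {σ K : Type*} [Field K]

open Classical in
/-- The coefficient of `y ^ d` in `f`, as a polynomial that does not involve `y`. -/
noncomputable def topCoeff (f : MvPolynomial σ K) (y : σ) (d : ℕ) : MvPolynomial σ K :=
  ∑ m ∈ f.support with m y = d, monomial (m.erase y) (f.coeff m)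

theorem exists_of_mem_support_topCoeff {f : MvPolynomial σ K} {y : σ} {d : ℕ} {n : σ →₀ ℕ}
    (hn : n ∈ (topCoeff f y d).support) : ∃ m ∈ f.support, m y = d ∧ m.erase y = n := by
  classical
  obtain ⟨m, hm, hmn⟩ := Finset.mem_biUnion.1 (support_sum hn)
  rw [Finset.mem_filter] at hm
  exact ⟨m, hm.1, hm.2, (Finset.mem_singleton.1 (support_monomial_subset hmn)).symm⟩

theorem coeff_erase_topCoeff {f : MvPolynomial σ K} {y : σ} {m : σ →₀ ℕ} (hm : m ∈ f.support) :
    (topCoeff f y (m y)).coeff (m.erase y) = f.coeff m := by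
  classical
  rw [topCoeff, coeff_sum, Finset.sum_eq_single m]
  · rw [coeff_monomial, if_pos rfl]
  · intro b hb hbm
    rw [coeff_monomial, if_neg]
    intro h
    rw [Finset.mem_filter] at hb
    apply hbm
    rw [← Finsupp.single_add_erase y b, ← Finsupp.single_add_erase y m, h, hb.2]
  · intro h
    exact (h (Finset.mem_filter.2 ⟨hm, rfl⟩)).elim

theorem topCoeff_zero {f : MvPolynomial σ K} {y : σ} (hf : ∀ m ∈ f.support, m y = 0) :
    topCoeff f y 0 = f := by
  classical
  conv_rhs => rw [f.as_sum]
  rw [topCoeff, Finset.filter_true_of_mem hf]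
  refine Finset.sum_congr rfl fun m hm ↦ ?_
  rw [Finsupp.erase_of_notMem_support]
  simpa using hf m hm

/-- If `f` vanishes along a family of points that is polynomial in `s`, except for the coordinate
`y`, which is `s⁻¹`, then the top coefficient of `f` vanishes at the limit for `s = 0`: it is the
value at `0` of the polynomial `s ^ d * f`. -/
theorem aeval_topCoeff_eq_zero {L : Type*} [Field L] [Infinite L] [Algebra K L] [DecidableEq σ]
    {f : MvPolynomial σ K} {y : σ} {d : ℕ} (hd : ∀ m ∈ f.support, m y ≤ d) (P : σ → Polynomial L)
    (h : ∀ s : L, s ≠ 0 → aeval (fun v ↦ if v = y then s⁻¹ else (P v).eval s) f = 0) :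
    aeval (fun v ↦ (P v).eval 0) (topCoeff f y d) = 0 := by
  classical
  let G : Polynomial L := ∑ m ∈ f.support, Polynomial.C (algebraMap K L (f.coeff m)) *
    Polynomial.X ^ (d - m y) * (m.erase y).prod fun v e ↦ P v ^ e
  have hG : ∀ s, G.eval s = ∑ m ∈ f.support, algebraMap K L (f.coeff m) * s ^ (d - m y) *
      (m.erase y).prod fun v e ↦ (P v).eval s ^ e := by
    intro s
    simp only [G, Polynomial.eval_finsetSum, Polynomial.eval_mul, Polynomial.eval_C,
      Polynomial.eval_pow, Polynomial.eval_X, Finsupp.prod, Polynomial.eval_prod]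
  have hGs : ∀ s : L, s ≠ 0 → G.eval s = 0 := by
    intro s hs
    rw [hG, ← mul_zero (s ^ d), ← h s hs]
    conv_rhs => rw [f.as_sum]
    rw [map_sum, Finset.mul_sum]
    refine Finset.sum_congr rfl fun m hm ↦ ?_
    rw [aeval_monomial, ← Finsupp.mul_prod_erase' m y _ fun _ ↦ pow_zero _, if_pos rfl,
      ← Nat.sub_add_cancel (hd m hm), pow_add, Nat.sub_add_cancel (hd m hm)]
    have h1 : ((m.erase y).prod fun v e ↦ (if v = y then s⁻¹ else (P v).eval s) ^ e) =
        (m.erase y).prod fun v e ↦ (P v).eval s ^ e := by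
      refine Finsupp.prod_congr fun v hv ↦ ?_
      rw [if_neg]
      rintro rfl
      simp at hv
    have h2 : s ^ m y * s⁻¹ ^ m y = 1 := by rw [← mul_pow, mul_inv_cancel₀ hs, one_pow]
    rw [h1]
    linear_combination (-(algebraMap K L (f.coeff m)) * s ^ (d - m y) *
      ((m.erase y).prod fun v e ↦ (P v).eval s ^ e)) * h2
  have hG0 : G = 0 := by
    refine Polynomial.eq_zero_of_infinite_isRoot _ ?_
    exact (Set.finite_singleton (0 : L)).infinite_compl.mono fun s hs ↦ hGs s hs
  have h0 := hG 0
  rw [hG0, Polynomial.eval_zero] at h0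
  rw [topCoeff, map_sum, Finset.sum_filter]
  refine Eq.trans (Finset.sum_congr rfl fun m hm ↦ ?_) h0.symm
  split_ifs with hmd
  · rw [aeval_monomial, hmd, Nat.sub_self, pow_zero, mul_one]
  · rw [zero_pow (by have := hd m hm; omega), mul_zero, zero_mul]

variable {mo : MonomialOrder σ} {f : MvPolynomial σ K} {y : σ}

/-- The leading monomial of a polynomial has the largest exponent at the largest variable. -/
theorem apply_le_degree_apply (hlex : IsLexicographic mo)
    (hf : ∀ m ∈ f.support, ∀ v, varLT mo y v → m v = 0) (hf0 : f ≠ 0) {m : σ →₀ ℕ}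
    (hm : m ∈ f.support) : m y ≤ mo.degree f y := by
  by_contra! h
  refine (mo.le_degree hm).not_gt ((hlex _ _).2 ⟨y, h, fun v hv ↦ ?_⟩)
  rw [hf m hm v hv, hf _ (mo.degree_mem_support hf0) v hv]

theorem degree_topCoeff (hf0 : f ≠ 0) :
    mo.degree (topCoeff f y (mo.degree f y)) = (mo.degree f).erase y := by
  apply mo.toSyn.injective
  apply le_antisymm
  · rw [mo.degree_le_iff]
    intro n hn
    obtain ⟨m, hm, hmy, rfl⟩ := exists_of_mem_support_topCoeff hn
    have h1 := mo.le_degree hm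
    rw [← Finsupp.single_add_erase y m, ← Finsupp.single_add_erase y (mo.degree f), hmy, map_add,
      map_add] at h1
    exact le_of_add_le_add_left h1
  · apply mo.le_degree
    rw [mem_support_iff, coeff_erase_topCoeff (mo.degree_mem_support hf0)]
    exact mem_support_iff.1 (mo.degree_mem_support hf0)

theorem topCoeff_ne_zero (hf0 : f ≠ 0) : topCoeff f y (mo.degree f y) ≠ 0 := by
  intro h
  have h1 := coeff_erase_topCoeff (y := y) (mo.degree_mem_support hf0)
  rw [h, coeff_zero] at h1
  exact mem_support_iff.1 (mo.degree_mem_support hf0) h1.symm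

theorem vars_topCoeff_subset (d : ℕ) :
    ∀ v ∈ (topCoeff f y d).vars, v ∈ f.vars ∧ v ≠ y := by
  classical
  intro v hv
  obtain ⟨n, hn, hvn⟩ := (mem_vars_iff_mem_support v).1 hv
  obtain ⟨m, hm, -, rfl⟩ := exists_of_mem_support_topCoeff hn
  rw [Finsupp.support_erase, Finset.mem_erase] at hvn
  exact ⟨(mem_vars_iff_mem_support v).2 ⟨m, hm, hvn.2⟩, hvn.1⟩

end TopCoeff

/-! ### Polynomials that vanish under the rank conditions -/

/-- A chain that can be continued to an element of `T` contains, together with that element, chains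
of all smaller lengths. -/
theorem HasChain.exists_end {τ γ : Type*} {lt : τ → τ → Prop} {T : Set τ} {g : τ → γ}
    (hg : ∀ a b, lt a b → g a = g b) {n : ℕ} {p : τ} (h : HasChain lt T n p) (hp : p ∈ T)
    {m : ℕ} (hm : m ≤ n) : ∃ z ∈ T, g z = g p ∧ HasChain lt T m z := by
  induction h with
  | zero p => exact ⟨p, hp, rfl, Nat.le_zero.1 hm ▸ .zero p⟩
  | @succ n z p hz hlt h ih =>
    rcases hm.eq_or_lt with rfl | hm'
    · exact ⟨p, hp, rfl, .succ hz hlt h⟩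
    · obtain ⟨z', hz', hg', h'⟩ := ih hz (by omega)
      exact ⟨z', hz', hg'.trans (hg _ _ hlt), h'⟩

namespace PageLayout

variable {π ρ κ A B : Type*} (D : PageLayout π ρ κ A B)

/-- The value of a point at a cell. -/
def valueAt {L : Type*} (x : π → ρ → κ → L) (p : π × ρ × κ) : L := x p.1 p.2.1 p.2.2

theorem valueAt_fill_of_ne {L : Type*} (x : π → ρ → κ → L) {y p : π × ρ × κ} (w : L) (h : p ≠ y) :
    valueAt (fill x y w) p = valueAt x p := fill_of_ne x w h

variable [LinearOrder π] [LinearOrder ρ] [LinearOrder κ]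

section Deform

variable {R : Type*} [CommRing R] {x : π → ρ → κ → R} {y : π × ρ × κ} {s w : R}

theorem valueAt_deform_self : valueAt (D.deform x y s w) y = w := deform_self

theorem valueAt_deform_of_ne (w' : R) {p : π × ρ × κ} (h : p ≠ y) :
    valueAt (D.deform x y s w) p = valueAt (D.deform x y s w') p := by
  simp only [valueAt, deform]
  rw [if_neg (show ¬ (p.1, p.2.1, p.2.2) = y from h),
    if_neg (show ¬ (p.1, p.2.1, p.2.2) = y from h)]

theorem valueAt_deform_zero {p : π × ρ × κ} (h : p ≠ y) :
    valueAt (D.deform x y 0 w) p = valueAt x p := by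
  simp only [valueAt, deform]
  rw [if_neg (show ¬ (p.1, p.2.1, p.2.2) = y from h)]
  simp [rowCoef, colCoef]

/-- The deformation is polynomial in its parameter. -/
theorem eval_deform (x : π → ρ → κ → R) (y : π × ρ × κ) (s : R) (p : π × ρ × κ) :
    (valueAt (D.deform (fun k i j ↦ Polynomial.C (x k i j)) y Polynomial.X 0) p).eval s =
      valueAt (D.deform x y s 0) p := by
  have h1 : ∀ k i, (D.rowCoef (fun k i j ↦ Polynomial.C (x k i j)) y Polynomial.X k i).eval s =
      D.rowCoef x y s k i := by
    intro k i
    unfold rowCoef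
    split_ifs <;> simp only [Polynomial.eval_mul, Polynomial.eval_C, Polynomial.eval_X,
      Polynomial.eval_zero]
  have h2 : ∀ k j, (D.colCoef (fun k i j ↦ Polynomial.C (x k i j)) y Polynomial.X k j).eval s =
      D.colCoef x y s k j := by
    intro k j
    unfold colCoef
    split_ifs <;> simp only [Polynomial.eval_mul, Polynomial.eval_C, Polynomial.eval_X,
      Polynomial.eval_zero]
  simp only [valueAt, deform]
  split_ifs <;> simp only [h1, h2, Polynomial.eval_add, Polynomial.eval_mul, Polynomial.eval_C,
    Polynomial.eval_X, Polynomial.eval_zero]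

/-- The deformed point vanishes outside the cells, because the cells of a source or of a target form
a rectangle. -/
theorem deform_eq_zero_of_notMem (hy : y ∈ D.cells)
    (hx : ∀ k i j, (k, i, j) ∉ D.cells → x k i j = 0) :
    ∀ k i j, (k, i, j) ∉ D.cells → D.deform x y s w k i j = 0 := by
  intro k i j h
  obtain ⟨k₀, i₀, j₀⟩ := y
  have hrow : ∀ j', (k, i₀, j') ∈ D.cells → D.rowCoef x (k₀, i₀, j₀) s k i ≠ 0 →
      (k, i, j') ∈ D.cells := by
    intro j' h1 h2
    unfold rowCoef at h2
    split_ifs at h2 with h3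
    · have h4 : (k₀, i, j₀) ∈ D.cells := by
        by_contra h5
        exact h2 (by rw [hx _ _ _ h5, mul_zero])
      exact D.rect_tgt h4 h1 h3.2.1.symm
    · exact absurd rfl h2
  have hcol : ∀ i', (k, i', j₀) ∈ D.cells → D.colCoef x (k₀, i₀, j₀) s k j ≠ 0 →
      (k, i', j) ∈ D.cells := by
    intro i' h1 h2
    unfold colCoef at h2
    split_ifs at h2 with h3
    · have h4 : (k₀, i₀, j) ∈ D.cells := by
        by_contra h5
        exact h2 (by rw [hx _ _ _ h5, mul_zero])
      exact D.rect_src h4 h1 h3.2.1.symm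
    · exact absurd rfl h2
  have hne : (k, i, j) ≠ (k₀, i₀, j₀) := fun h' ↦ h (h' ▸ hy)
  rw [deform, if_neg hne, hx k i j h]
  have e1 : (if k = k₀ ∧ i₀ < i ∧ j₀ < j then s * x k i j₀ * x k i₀ j else 0) = 0 := by
    split_ifs
    · by_cases h1 : (k, i, j₀) ∈ D.cells
      · rw [hx k i₀ j fun h2 ↦ h (D.rect_tgt h1 h2 rfl), mul_zero]
      · rw [hx _ _ _ h1, mul_zero, zero_mul]
    · rfl
  have e2 : D.rowCoef x (k₀, i₀, j₀) s k i * x k i₀ j = 0 := by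
    by_contra h0
    refine h (hrow j ?_ (left_ne_zero_of_mul h0))
    by_contra h1
    exact right_ne_zero_of_mul h0 (hx _ _ _ h1)
  have e3 : D.colCoef x (k₀, i₀, j₀) s k j * x k i j₀ = 0 := by
    by_contra h0
    refine h (hcol i ?_ (left_ne_zero_of_mul h0))
    by_contra h1
    exact right_ne_zero_of_mul h0 (hx _ _ _ h1)
  have e4 : D.rowCoef x (k₀, i₀, j₀) s k i * D.colCoef x (k₀, i₀, j₀) s k j * x k i₀ j₀ = 0 := by
    by_contra h0
    have h1 := left_ne_zero_of_mul h0
    refine h (hcol i (hrow j₀ ?_ (left_ne_zero_of_mul h1)) (right_ne_zero_of_mul h1))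
    by_contra h2
    exact right_ne_zero_of_mul h0 (hx _ _ _ h2)
  dsimp only
  rw [e1, e2, e3, e4]
  simp only [add_zero]

end Deform

/-- The set `T` contains a chain that has `u + 1` elements in the matrix of some target, or `v + 1`
elements in the matrix of some source. -/
def HasLongChain (u : A → ℕ) (v : B → ℕ) (T : Set (π × ρ × κ)) : Prop :=
  (∃ p ∈ T, HasChain D.SinkLT T (u (D.tgt p.1)) p) ∨
    ∃ p ∈ T, HasChain D.transpose.SinkLT (flip '' T) (v (D.src p.1)) (flip p)

variable {D} {u : A → ℕ} {v : B → ℕ}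

theorem HasLongChain.mono {S T : Set (π × ρ × κ)} (hST : S ⊆ T) (h : D.HasLongChain u v S) :
    D.HasLongChain u v T := by
  rcases h with ⟨p, hp, h⟩ | ⟨p, hp, h⟩
  · exact Or.inl ⟨p, hST hp, h.mono hST⟩
  · exact Or.inr ⟨p, hST hp, h.mono (Set.image_mono hST)⟩

theorem hasChain_le_of_not_hasLongChain {T : Set (π × ρ × κ)} (hT : ¬ D.HasLongChain u v T) {n : ℕ}
    {p : π × ρ × κ} (h : HasChain D.SinkLT T n p) : n ≤ u (D.tgt p.1) := by
  cases h with
  | zero => exact Nat.zero_le _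
  | @succ n z _ hz hlt h =>
    by_contra! hn
    obtain ⟨z', hz', hg, h'⟩ := h.exists_end (g := fun z ↦ D.tgt z.1) (fun _ _ h ↦ h.1) hz
      (Nat.lt_succ_iff.1 hn)
    refine hT (Or.inl ⟨z', hz', ?_⟩)
    rwa [hg, hlt.1]

theorem hasChain_lt_of_not_hasLongChain {T : Set (π × ρ × κ)} (hT : ¬ D.HasLongChain u v T) {n : ℕ}
    {p : π × ρ × κ} (hp : p ∈ T) (h : HasChain D.SinkLT T n p) : n + 1 ≤ u (D.tgt p.1) := by
  by_contra! hn
  obtain ⟨z', hz', hg, h'⟩ := h.exists_end (g := fun z ↦ D.tgt z.1) (fun _ _ h ↦ h.1) hp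
    (Nat.lt_succ_iff.1 hn)
  refine hT (Or.inl ⟨z', hz', ?_⟩)
  rwa [hg]

theorem HasLongChain.of_transpose {T : Set (π × ρ × κ)}
    (h : D.transpose.HasLongChain v u (flip '' T)) : D.HasLongChain u v T := by
  have himg : flip '' (flip '' T) = T := by simp [Set.image_image]
  rcases h with ⟨_, ⟨p, hp, rfl⟩, h⟩ | ⟨_, ⟨p, hp, rfl⟩, h⟩
  · exact Or.inr ⟨p, hp, h⟩
  · rw [himg] at h
    exact Or.inl ⟨p, hp, h⟩

section Main

variable [Fintype π] [Fintype ρ] [Fintype κ] {σ K L : Type*} [Field K] [Field L] [Infinite L]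
  [Algebra K L] {mo : MonomialOrder σ} {φ : σ → π × ρ × κ}

variable (D u v) in
/-- The points that vanish outside the cells and satisfy all conditions at the corners in `Rem`. -/
def Points (L : Type*) [Field L] (S Rem : Set (π × ρ × κ)) : Set (π → ρ → κ → L) :=
  {x | (∀ k i j, (k, i, j) ∉ D.cells → x k i j = 0) ∧ D.SinkCond u S Rem x ∧
    D.transpose.SinkCond v (flip '' S) (flip '' Rem) fun k j i ↦ x k i j}

omit [Fintype π] [Fintype ρ] [Fintype κ] in
/-- The largest remaining variable is a corner. -/
theorem isCorner_of_max [DecidableEq σ] (hcells : D.cells = Set.range φ)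
    (hD : ∀ p q, D.SinkLE (φ p) (φ q) → p = q ∨ varLT mo q p)
    (hD' : ∀ p q, D.transpose.SinkLE (flip (φ p)) (flip (φ q)) → p = q ∨ varLT mo q p)
    {Rem : Finset σ} {S : Set σ} (hlow : ∀ p ∈ Rem, ∀ q, varLT mo q p → q ∈ Rem)
    (hS : ∀ z ∈ S, ∀ p ∈ Rem, varLT mo p z) {y : σ} (hy : y ∈ Rem)
    (hmax : ∀ p ∈ Rem, p ≠ y → varLT mo p y) :
    D.IsCorner (φ '' S) (φ '' (Rem.erase y : Finset σ)) (φ y) := by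
  have key1 : ∀ p ∈ Rem.erase y, ¬ (p = y ∨ varLT mo y p) := by
    intro p hp h
    rw [Finset.mem_erase] at hp
    exact h.elim hp.1 fun h ↦ lt_asymm h (hmax p hp.2 hp.1)
  have key2 : ∀ p, φ p ≠ φ y → (y = p ∨ varLT mo p y) → p ∈ Rem.erase y := by
    intro p hp h
    have hne : p ≠ y := fun h' ↦ hp (congrArg φ h')
    exact Finset.mem_erase.2 ⟨hne, h.elim (fun h ↦ absurd h.symm hne) (hlow y hy p)⟩
  have key3 : ∀ z ∈ S, ¬ (y = z ∨ varLT mo z y) := by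
    intro z hz h
    have h' := hS z hz y hy
    rcases h with rfl | h
    · exact lt_irrefl _ h'
    · exact lt_asymm h h'
  refine ⟨hcells ▸ ⟨y, rfl⟩, ?_, ?_, ?_, ?_, ?_, ?_, ?_⟩
  · rintro _ ⟨p, -, rfl⟩
    exact hcells ▸ ⟨p, rfl⟩
  · rintro _ ⟨p, hp, rfl⟩ h
    exact key1 p hp (hD _ _ h)
  · rw [hcells]
    rintro _ ⟨p, rfl⟩ h hne
    exact ⟨p, key2 p hne (hD _ _ h), rfl⟩
  · rintro _ ⟨z, hz, rfl⟩ h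
    exact key3 z hz (hD _ _ h)
  · rintro _ ⟨p, hp, rfl⟩ h
    exact key1 p hp (hD' _ _ h)
  · rw [hcells]
    rintro _ ⟨p, rfl⟩ h hne
    exact ⟨p, key2 p hne (hD' _ _ h), rfl⟩
  · rintro _ ⟨z, hz, rfl⟩ h
    exact key3 z hz (hD' _ _ h)

omit [Fintype π] [Fintype ρ] [Fintype κ] in
/-- If `f` vanishes on all deformations of `x` at `y`, then its top coefficient with respect to `y`
vanishes at `x`. -/
theorem aeval_topCoeff_of_deform (hφ : Function.Injective φ) {f : MvPolynomial σ K} {y : σ} {d : ℕ}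
    (hd : ∀ m ∈ f.support, m y ≤ d) {x : π → ρ → κ → L}
    (h : ∀ s : L, s ≠ 0 → aeval (fun v ↦ valueAt (D.deform x (φ y) s s⁻¹) (φ v)) f = 0) :
    aeval (fun v ↦ valueAt x (φ v)) (topCoeff f y d) = 0 := by
  classical
  let P : σ → Polynomial L := fun v ↦ if v = y then Polynomial.C (valueAt x (φ y)) else
    valueAt (D.deform (fun k i j ↦ Polynomial.C (x k i j)) (φ y) Polynomial.X 0) (φ v)
  have hP : (fun v ↦ valueAt x (φ v)) = fun v ↦ (P v).eval 0 := by
    ext v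
    simp only [P]
    split_ifs with hv
    · rw [hv, Polynomial.eval_C]
    · rw [eval_deform, valueAt_deform_zero]
      exact fun h ↦ hv (hφ h)
  rw [hP]
  refine aeval_topCoeff_eq_zero hd P fun s hs ↦ ?_
  rw [← h s hs]
  congr 2
  ext v
  split_ifs with hv
  · rw [hv, valueAt_deform_self]
  · simp only [P, if_neg hv]
    rw [eval_deform, valueAt_deform_of_ne]
    exact fun h ↦ hv (hφ h)

/-- The leading monomial of a nonzero polynomial that vanishes on all points satisfying the rank
conditions contains, together with `S`, a long chain. The proof removes the largest remaining
variable `y`. If `y` occurs in `f`, then the deformations with a pole at `y` show that the top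
coefficient of `f` satisfies the hypothesis for `S ∪ {y}`; otherwise `f` itself satisfies it for the
same `S`, because each point can be filled in or deformed at `y`. -/
theorem hasLongChain_of_vanishing (hlex : IsLexicographic mo) (hφ : Function.Injective φ)
    (hcells : D.cells = Set.range φ)
    (hD : ∀ p q, D.SinkLE (φ p) (φ q) → p = q ∨ varLT mo q p)
    (hD' : ∀ p q, D.transpose.SinkLE (flip (φ p)) (flip (φ q)) → p = q ∨ varLT mo q p)
    (Rem : Finset σ) (S : Set σ) (hlow : ∀ p ∈ Rem, ∀ q, varLT mo q p → q ∈ Rem)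
    (hS : ∀ z ∈ S, ∀ p ∈ Rem, varLT mo p z) {f : MvPolynomial σ K} (hf0 : f ≠ 0)
    (hvars : f.vars ⊆ Rem)
    (hvan : ∀ x ∈ D.Points u v L (φ '' S) (φ '' Rem), aeval (fun v ↦ valueAt x (φ v)) f = 0) :
    D.HasLongChain u v (φ '' (S ∪ (mo.degree f).support)) := by
  classical
  induction hn : Rem.card generalizing Rem S f with
  | zero =>
    rw [Finset.card_eq_zero] at hn
    subst hn
    rw [Finset.subset_empty, vars_eq_empty_iff_eq_C] at hvars
    have h0 := hvan (fun _ _ _ ↦ 0) ⟨fun _ _ _ _ ↦ rfl, by simp [SinkCond], by simp [SinkCond]⟩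
    rw [hvars, aeval_C, map_eq_zero] at h0
    rw [hvars, h0, C_0] at hf0
    exact absurd rfl hf0
  | succ n ih =>
    by_cases hlong : D.HasLongChain u v (φ '' S)
    · exact hlong.mono (Set.image_mono Set.subset_union_left)
    have hne : Rem.Nonempty := by rw [← Finset.card_pos]; omega
    obtain ⟨y, hy, hmax'⟩ :=
      Rem.exists_max_image (fun v ↦ mo.toSyn (Finsupp.single v 1)) hne
    have hmax : ∀ p ∈ Rem, p ≠ y → varLT mo p y := fun p hp hpy ↦
      (hmax' p hp).lt_of_ne fun h ↦
        hpy (Finsupp.single_left_injective one_ne_zero (mo.toSyn.injective h))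
    have hc := isCorner_of_max hcells hD hD' hlow hS hy hmax
    have hcard : (Rem.erase y).card = n := by rw [Finset.card_erase_of_mem hy, hn]; rfl
    have hlow' : ∀ p ∈ Rem.erase y, ∀ q, varLT mo q p → q ∈ Rem.erase y := by
      intro p hp q hq
      rw [Finset.mem_erase] at hp ⊢
      refine ⟨?_, hlow p hp.2 q hq⟩
      rintro rfl
      exact lt_asymm hq (hmax p hp.2 hp.1)
    have hRem : φ '' (Rem : Set σ) = insert (φ y) (φ '' (Rem.erase y : Finset σ)) := by
      rw [← Set.image_insert_eq, ← Finset.coe_insert, Finset.insert_erase hy]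
    have hbig : ∀ m ∈ f.support, ∀ v, varLT mo y v → m v = 0 := by
      intro m hm v hv
      by_contra hmv
      have hvR := hvars ((mem_vars_iff_mem_support v).2 ⟨m, hm, Finsupp.mem_support_iff.2 hmv⟩)
      have hvy : v ≠ y := by rintro rfl; exact lt_irrefl _ hv
      exact lt_asymm hv (hmax v hvR hvy)
    have hd : ∀ m ∈ f.support, m y ≤ mo.degree f y := fun m hm ↦
      apply_le_degree_apply hlex hbig hf0 hm
    have hdeform : ∀ x : π → ρ → κ → L, (∀ k i j, (k, i, j) ∉ D.cells → x k i j = 0) →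
        (∀ s : L, s ≠ 0 → D.SinkCond u (φ '' S) (insert (φ y) (φ '' (Rem.erase y : Finset σ)))
            (D.deform x (φ y) s s⁻¹) ∧
          D.transpose.SinkCond v (flip '' (φ '' S))
            (flip '' insert (φ y) (φ '' (Rem.erase y : Finset σ)))
            fun k j i ↦ D.deform x (φ y) s s⁻¹ k i j) →
        aeval (fun v ↦ valueAt x (φ v)) (topCoeff f y (mo.degree f y)) = 0 := by
      intro x hx hs
      refine aeval_topCoeff_of_deform (D := D) hφ hd fun s hs0 ↦ hvan _ ?_
      rw [hRem]
      exact ⟨D.deform_eq_zero_of_notMem hc.mem hx, hs s hs0⟩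
    have htop0 : topCoeff f y (mo.degree f y) ≠ 0 := topCoeff_ne_zero hf0
    have hvarstop : (topCoeff f y (mo.degree f y)).vars ⊆ Rem.erase y := by
      intro v hv
      have h := vars_topCoeff_subset _ v hv
      exact Finset.mem_erase.2 ⟨h.2, hvars h.1⟩
    rcases Nat.eq_zero_or_pos (mo.degree f y) with hdeg | hdeg
    · rw [hdeg] at hdeform htop0 hvarstop
      have htop : topCoeff f y 0 = f :=
        topCoeff_zero fun m hm ↦ Nat.le_zero.1 (hdeg ▸ hd m hm)
      rw [htop] at hdeform hvarstop
      refine ih (Rem.erase y) S hlow' (fun z hz p hp ↦ hS z hz p (Finset.mem_of_mem_erase hp)) hf0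
        hvarstop ?_ hcard
      rintro x ⟨hx, hx1, hx2⟩
      rcases exists_fill_or_deform hx hc hx1 hx2
          (fun n h ↦ hasChain_le_of_not_hasLongChain hlong h)
          (fun n h ↦ hasChain_le_of_not_hasLongChain (D := D.transpose) (u := v) (v := u)
            (fun h ↦ hlong h.of_transpose) h) with ⟨w, hw⟩ | h
      · rw [← hvan (fill x (φ y) w)]
        · refine hom_congr_vars (f₁ := (aeval _ : MvPolynomial σ K →ₐ[K] L).toRingHom)
            (f₂ := (aeval _ : MvPolynomial σ K →ₐ[K] L).toRingHom) ?_ ?_ rfl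
          · ext a
            simp
          · intro v hv _
            simp only [AlgHom.toRingHom_eq_coe, RingHom.coe_coe, aeval_X]
            refine (valueAt_fill_of_ne _ _ fun h ↦ ?_).symm
            have := hvarstop hv
            rw [hφ h] at this
            simp at this
        · rw [hRem]
          refine ⟨fun k i j h ↦ ?_, hw⟩
          rw [fill_of_ne, hx _ _ _ h]
          exact fun h' ↦ h (h' ▸ hc.mem)
      · exact hdeform x hx h
    · by_cases hlong' : D.HasLongChain u v (φ '' insert y S)
      · refine hlong'.mono (Set.image_mono (Set.insert_subset (Or.inr ?_) Set.subset_union_left))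
        exact Finsupp.mem_support_iff.2 hdeg.ne'
      have h := ih (Rem.erase y) (insert y S) hlow' ?_ htop0 hvarstop ?_ hcard
      · refine h.mono (Set.image_mono ?_)
        rw [degree_topCoeff hf0, Finsupp.support_erase]
        rintro z ((rfl | hz) | hz)
        · exact Or.inr (Finsupp.mem_support_iff.2 hdeg.ne')
        · exact Or.inl hz
        · exact Or.inr (Finset.mem_of_mem_erase hz)
      · rintro z (rfl | hz) p hp
        · exact hmax p (Finset.mem_of_mem_erase hp) (Finset.ne_of_mem_erase hp)
        · exact hS z hz p (Finset.mem_of_mem_erase hp)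
      · rintro x ⟨hx, hx1, hx2⟩
        rw [Set.image_insert_eq] at hx1 hx2 hlong'
        have hx2' := hx2
        rw [Set.image_insert_eq] at hx2'
        refine hdeform x hx fun s hs ↦ ⟨?_, ?_⟩
        · refine (hx1.mono (Set.subset_insert _ _)).deform hc (fun n hn ↦ ?_) hs
          exact hx1.rank_block_add_one_le hx hc hn (hasChain_lt_of_not_hasLongChain hlong'
            (Set.mem_insert _ _) (hn.mono (Set.subset_insert _ _)))
        · rw [deform_transpose, Set.image_insert_eq]
          refine (hx2'.mono (Set.subset_insert _ _)).deform hc.transpose (fun n hn ↦ ?_) hs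
          refine hx2'.rank_block_add_one_le (fun k j i h ↦ hx k i j h) hc.transpose hn ?_
          have hlong'' : ¬ D.transpose.HasLongChain v u (insert (flip (φ y)) (flip '' (φ '' S))) := by
            rw [← Set.image_insert_eq]
            exact fun h ↦ hlong' h.of_transpose
          exact hasChain_lt_of_not_hasLongChain hlong''
            (Set.mem_insert _ _) (hn.mono (Set.subset_insert _ _))

end Main

end PageLayout

/-! ### Leading terms of minors -/

section Minors

variable {σ ρ κ K : Type*} [LinearOrder ρ] [LinearOrder κ] [Field K] {mo : MonomialOrder σ}

theorem IsConsistent.transpose {C : Matrix ρ κ σ} (h : IsConsistent mo C) :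
    IsConsistent mo C.transpose :=
  ⟨fun j i i' hi ↦ h.2 i i' j hi, fun j j' i hj ↦ h.1 i j j' hj⟩

theorem minors_transpose {R : Type*} [CommRing R] (n : ℕ) (A : Matrix ρ κ R) :
    minors n A.transpose = minors n A := by
  ext f
  constructor
  · rintro ⟨rows, cols, rfl⟩
    exact ⟨cols, rows, by rw [← Matrix.det_transpose]; rfl⟩
  · rintro ⟨rows, cols, rfl⟩
    exact ⟨cols, rows, by rw [← Matrix.det_transpose]; rfl⟩

theorem IsConsistent.eq_or_varLT {C : Matrix ρ κ σ} (h : IsConsistent mo C) {i i' : ρ} {j j' : κ}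
    (hi : i ≤ i') (hj : j ≤ j') : C i j = C i' j' ∨ varLT mo (C i' j') (C i j) := by
  rcases hi.eq_or_lt with rfl | hi
  · rcases hj.eq_or_lt with rfl | hj
    · exact Or.inl rfl
    · exact Or.inr (h.1 _ _ _ hj)
  · rcases hj.eq_or_lt with rfl | hj
    · exact Or.inr (h.2 _ _ _ hi)
    · exact Or.inr (lt_trans (h.2 _ _ _ hi) (h.1 _ _ _ hj))

/-- In the expansion of a minor the diagonal monomial is the largest: at the first row where a
permutation moves something, the diagonal entry exceeds all entries that the permutation selects
from there on. -/
theorem permMonomial_lt_diagonal (hlex : IsLexicographic mo) {n : ℕ}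
    {C : Matrix (Fin n) (Fin n) σ} (hC : IsConsistent mo C) {τ : Equiv.Perm (Fin n)} (hτ : τ ≠ 1) :
    (∑ i, Finsupp.single (C (τ i) i) 1) ≺[mo] ∑ i, Finsupp.single (C i i) 1 := by
  classical
  have hex : (Finset.univ.filter fun i ↦ τ i ≠ i).Nonempty := by
    by_contra h
    rw [Finset.not_nonempty_iff_eq_empty, Finset.filter_eq_empty_iff] at h
    exact hτ (Equiv.ext fun i ↦ not_not.1 (h (Finset.mem_univ i)))
  obtain ⟨a, ha, hmin⟩ := Finset.exists_min_image _ id hex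
  have hfix : ∀ i, i < a → τ i = i := by
    intro i hi
    by_contra h
    exact (hmin i (Finset.mem_filter.2 ⟨Finset.mem_univ i, h⟩)).not_gt hi
  have hge : ∀ i, a ≤ i → a ≤ τ i := by
    intro i hi
    by_contra! h
    have := hfix _ h
    rw [τ.injective this] at h
    exact h.not_ge hi
  have hτa : τ a ≠ a := (Finset.mem_filter.1 ha).2
  have hsmall : ∀ i, a ≤ i → varLT mo (C (τ i) i) (C a a) := by
    intro i hi
    rcases hi.eq_or_lt with rfl | hi'
    · exact hC.2 _ _ _ ((hge _ le_rfl).lt_of_ne hτa.symm)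
    · rcases (hge i hi).eq_or_lt with h | h
      · rw [← h]
        exact hC.1 _ _ _ hi'
      · exact lt_trans (hC.1 _ _ _ hi') (hC.2 _ _ _ h)
  have hsmall' : ∀ i, a < i → varLT mo (C i i) (C a a) := fun i hi ↦
    lt_trans (hC.1 _ _ _ hi) (hC.2 _ _ _ hi)
  refine (hlex _ _).2 ⟨C a a, ?_, fun v hv ↦ ?_⟩
  · rw [Finsupp.finsetSum_apply, Finsupp.finsetSum_apply]
    refine Finset.sum_lt_sum (fun i _ ↦ ?_) ⟨a, Finset.mem_univ a, ?_⟩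
    · rcases lt_or_ge i a with hi | hi
      · rw [hfix i hi]
      · rw [Finsupp.single_eq_of_ne]
        · exact Nat.zero_le _
        · intro h
          have := hsmall i hi
          rw [← h] at this
          exact lt_irrefl _ this
    · rw [Finsupp.single_eq_same, Finsupp.single_eq_of_ne]
      · exact Nat.zero_lt_one
      · intro h
        have := hsmall a le_rfl
        rw [← h] at this
        exact lt_irrefl _ this
  · rw [Finsupp.finsetSum_apply, Finsupp.finsetSum_apply]
    refine Finset.sum_congr rfl fun i _ ↦ ?_
    rcases lt_or_ge i a with hi | hi
    · rw [hfix i hi]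
    · rw [Finsupp.single_eq_of_ne, Finsupp.single_eq_of_ne]
      · rintro rfl
        rcases hi.eq_or_lt with rfl | hi'
        · exact lt_irrefl _ hv
        · exact lt_asymm hv (hsmall' i hi')
      · rintro rfl
        exact lt_asymm hv (hsmall i hi)

theorem det_varMatrix_eq_sum {n : ℕ} (C : Matrix (Fin n) (Fin n) σ) :
    (varMatrix K C).det = ∑ τ : Equiv.Perm (Fin n),
      monomial (∑ i, Finsupp.single (C (τ i) i) 1) ((Equiv.Perm.sign τ : ℤ) : K) := by
  rw [Matrix.det_apply']
  refine Finset.sum_congr rfl fun τ _ ↦ ?_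
  have h1 : ∏ i, varMatrix K C (τ i) i = monomial (∑ i, Finsupp.single (C (τ i) i) 1) (1 : K) := by
    rw [monomial_sum_one]
    rfl
  rw [h1, ← map_intCast (MvPolynomial.C : K →+* MvPolynomial σ K), C_mul_monomial, mul_one]

theorem coeff_diagonal_det (hlex : IsLexicographic mo) {n : ℕ} {C : Matrix (Fin n) (Fin n) σ}
    (hC : IsConsistent mo C) :
    (varMatrix K C).det.coeff (∑ i, Finsupp.single (C i i) 1) = 1 := by
  classical
  rw [det_varMatrix_eq_sum, coeff_sum, Finset.sum_eq_single 1]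
  · simp [coeff_monomial]
  · intro τ _ hτ
    rw [coeff_monomial, if_neg]
    intro h
    have := permMonomial_lt_diagonal hlex hC hτ
    rw [h] at this
    exact lt_irrefl _ this
  · intro h
    exact absurd (Finset.mem_univ _) h

theorem degree_det_varMatrix (hlex : IsLexicographic mo) {n : ℕ} {C : Matrix (Fin n) (Fin n) σ}
    (hC : IsConsistent mo C) :
    mo.degree (varMatrix K C).det = ∑ i, Finsupp.single (C i i) 1 := by
  classical
  apply mo.toSyn.injective
  apply le_antisymm
  · rw [mo.degree_le_iff, det_varMatrix_eq_sum]
    intro c hc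
    obtain ⟨τ, -, hτ⟩ := Finset.mem_biUnion.1 (support_sum hc)
    rw [Finset.mem_singleton.1 (support_monomial_subset hτ)]
    by_cases h1 : τ = 1
    · subst h1
      rfl
    · exact (permMonomial_lt_diagonal hlex hC h1).le
  · apply mo.le_degree
    rw [mem_support_iff, coeff_diagonal_det hlex hC]
    exact one_ne_zero

theorem leadingTerm_det_varMatrix (hlex : IsLexicographic mo) {n : ℕ}
    {C : Matrix (Fin n) (Fin n) σ} (hC : IsConsistent mo C) :
    mo.leadingTerm (varMatrix K C).det = monomial (∑ i, Finsupp.single (C i i) 1) 1 := by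
  rw [MonomialOrder.leadingTerm, MonomialOrder.leadingCoeff, degree_det_varMatrix hlex hC,
    coeff_diagonal_det hlex hC]

theorem IsConsistent.submatrix {C : Matrix ρ κ σ} (h : IsConsistent mo C) {n : ℕ}
    (rows : Fin n ↪o ρ) (cols : Fin n ↪o κ) : IsConsistent mo (C.submatrix rows cols) :=
  ⟨fun _ _ _ hj ↦ h.1 _ _ _ (cols.strictMono hj), fun _ _ _ hi ↦ h.2 _ _ _ (rows.strictMono hi)⟩

end Minors

/-! ### Matrices of variables in a layout -/

namespace PageLayout

variable {π ρ κ A B : Type*} (D : PageLayout π ρ κ A B)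
  [LinearOrder π] [LinearOrder ρ] [LinearOrder κ]

/-- `C` is the matrix of the target `α`: its rows and columns are placed in the layout in an
order-preserving way, and it contains all variables on pages with target `α`. -/
structure Represents {σ ρ' κ' : Type*} [LinearOrder ρ'] [LinearOrder κ'] (φ : σ → π × ρ × κ) (α : A)
    (C : Matrix ρ' κ' σ) where
  row : ρ' → ρ
  col : κ' → π ×ₗ κ
  row_strictMono : StrictMono row
  col_strictMono : StrictMono col
  apply_eq : ∀ i c, φ (C i c) = ((ofLex (col c)).1, row i, (ofLex (col c)).2)
  tgt_eq : ∀ c, D.tgt (ofLex (col c)).1 = α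
  exists_eq : ∀ v, D.tgt (φ v).1 = α → ∃ i c, C i c = v

variable {D} {σ ρ' κ' : Type*} [LinearOrder ρ'] [LinearOrder κ'] {φ : σ → π × ρ × κ} {α : A}
  {C : Matrix ρ' κ' σ}

theorem Represents.eq_or_varLT {mo : MonomialOrder σ} (h : D.Represents φ α C)
    (hC : IsConsistent mo C) {p q : σ} (hq : D.tgt (φ q).1 = α) (hpq : D.SinkLE (φ p) (φ q)) :
    p = q ∨ varLT mo q p := by
  obtain ⟨i, c, rfl⟩ := h.exists_eq p (hpq.1.trans hq)
  obtain ⟨i', c', rfl⟩ := h.exists_eq q hq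
  obtain ⟨-, h1, h2⟩ := hpq
  rw [h.apply_eq, h.apply_eq] at h1 h2
  exact hC.eq_or_varLT (h.row_strictMono.le_iff_le.1 h1) (h.col_strictMono.le_iff_le.1 h2)

variable {K : Type*} [Field K]

/-- The minors vanish on the points of bounded rank. -/
theorem Represents.aeval_minor_eq_zero [Fintype π] [Fintype ρ] [Fintype κ] {L : Type*} [Field L]
    [Algebra K L] (h : D.Represents φ α C) {u : A → ℕ} {x : π → ρ → κ → L}
    (hx : D.SinkCond u ∅ (Set.range φ) x) {f : MvPolynomial σ K}
    (hf : f ∈ minors (u α + 1) (varMatrix K C)) : aeval (fun v ↦ valueAt x (φ v)) f = 0 := by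
  obtain ⟨rows, cols, rfl⟩ := hf
  have htgt : D.tgt (φ (C (rows 0) (cols 0))).1 = α := by rw [h.apply_eq]; exact h.tgt_eq _
  have hrank := hx _ ⟨C (rows 0) (cols 0), rfl⟩ 0 (.zero _)
  rw [htgt, add_zero] at hrank
  set N := D.block x α (Set.Ici (φ (C (rows 0) (cols 0))).2.1)
    (Set.Ici (colPos (φ (C (rows 0) (cols 0))))) with hN
  have hmap : (aeval (R := K) fun v ↦ valueAt x (φ v)).mapMatrix
      ((varMatrix K C).submatrix rows cols) =
      N.submatrix (fun i ↦ h.row (rows i)) (fun j ↦ ofLex (h.col (cols j))) := by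
    ext i j
    rw [AlgHom.mapMatrix_apply, Matrix.map_apply, Matrix.submatrix_apply, Matrix.submatrix_apply,
      varMatrix, Matrix.map_apply, aeval_X, hN, block_apply_of_mem (h.tgt_eq _), valueAt,
      h.apply_eq]
    · rw [h.apply_eq]
      exact h.row_strictMono.monotone (rows.monotone (Fin.zero_le i))
    · rw [h.apply_eq]
      exact h.col_strictMono.monotone (cols.monotone (Fin.zero_le j))
  rw [AlgHom.map_det, hmap]
  by_contra hdet
  have h1 := Matrix.rank_of_det_ne_zero hdet
  have h2 := Matrix.rank_submatrix_le N (fun i ↦ h.row (rows i))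
    (fun j ↦ ofLex (h.col (cols j)))
  rw [h1, Fintype.card_fin] at h2
  omega

/-- A long chain of variables is the diagonal of a minor. -/
theorem Represents.exists_minor (h : D.Represents φ α C)
    {u : A → ℕ} {T : Set σ} {p : π × ρ × κ} (hp : p ∈ φ '' T) (hα : D.tgt p.1 = α)
    (hchain : HasChain D.SinkLT (φ '' T) (u α) p) :
    ∃ (rows : Fin (u α + 1) ↪o ρ') (cols : Fin (u α + 1) ↪o κ'), ∀ i, C (rows i) (cols i) ∈ T := by
  obtain ⟨c, hcT, hlt, hlast⟩ := hchain.exists_seq hp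
  have htgt : ∀ i, D.tgt (c i).1 = α := by
    intro i
    induction i using Fin.reverseInduction with
    | last => rw [hlast, hα]
    | cast i ih => rw [(hlt i).1, ih]
  choose t ht htc using hcT
  have hex : ∀ i, ∃ ac : ρ' × κ', C ac.1 ac.2 = t i := by
    intro i
    obtain ⟨a, b, hab⟩ := h.exists_eq (t i) (by rw [htc, htgt])
    exact ⟨(a, b), hab⟩
  choose e he using hex
  have hc : ∀ i, c i = ((ofLex (h.col (e i).2)).1, h.row (e i).1, (ofLex (h.col (e i).2)).2) := by
    intro i
    rw [← htc, ← he, h.apply_eq]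
  have hrow : StrictMono fun i ↦ (e i).1 := by
    refine Fin.strictMono_iff_lt_succ.2 fun i ↦ h.row_strictMono.lt_iff_lt.1 ?_
    have := (hlt i).2.1
    rwa [hc, hc] at this
  have hcol : StrictMono fun i ↦ (e i).2 := by
    refine Fin.strictMono_iff_lt_succ.2 fun i ↦ h.col_strictMono.lt_iff_lt.1 ?_
    have := (hlt i).2.2
    rwa [hc, hc] at this
  refine ⟨OrderEmbedding.ofStrictMono _ hrow, OrderEmbedding.ofStrictMono _ hcol, fun i ↦ ?_⟩
  change C (e i).1 (e i).2 ∈ T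
  rw [he]
  exact ht i

/-- A monomial that involves a long chain is divisible by the leading term of a minor. -/
theorem Represents.monomial_mem_span (h : D.Represents φ α C)
    {mo : MonomialOrder σ} (hlex : IsLexicographic mo) (hC : IsConsistent mo C) {u : A → ℕ}
    {m : σ →₀ ℕ} (a : K) {p : π × ρ × κ} (hp : p ∈ φ '' m.support) (hα : D.tgt p.1 = α)
    (hchain : HasChain D.SinkLT (φ '' m.support) (u α) p) :
    monomial m a ∈ Ideal.span (mo.leadingTerm '' minors (u α + 1) (varMatrix K C)) := by
  classical
  obtain ⟨rows, cols, hT⟩ := h.exists_minor hp hα hchain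
  have hlt := leadingTerm_det_varMatrix (K := K) hlex (hC.submatrix rows cols)
  have hinj : Function.Injective fun i ↦ C (rows i) (cols i) := by
    intro i j hij
    have := congrArg φ hij
    rw [h.apply_eq, h.apply_eq] at this
    exact rows.injective (h.row_strictMono.injective (congrArg (fun p ↦ p.2.1) this))
  have hle : (∑ i, Finsupp.single (C (rows i) (cols i)) 1) ≤ m := by
    intro v
    rw [Finsupp.finsetSum_apply]
    by_cases hv : ∃ i, C (rows i) (cols i) = v
    · obtain ⟨i, rfl⟩ := hv
      rw [Finset.sum_eq_single i]
      · rw [Finsupp.single_eq_same]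
        exact Nat.one_le_iff_ne_zero.2 (Finsupp.mem_support_iff.1 (hT i))
      · intro j _ hj
        exact Finsupp.single_eq_of_ne fun h ↦ hj (hinj h.symm)
      · intro h
        exact absurd (Finset.mem_univ _) h
    · rw [Finset.sum_eq_zero]
      · exact Nat.zero_le _
      · intro i _
        exact Finsupp.single_eq_of_ne fun h ↦ hv ⟨i, h.symm⟩
  have hmem : monomial (∑ i, Finsupp.single (C (rows i) (cols i)) 1) (1 : K) ∈
      Ideal.span (mo.leadingTerm '' minors (u α + 1) (varMatrix K C)) :=
    Ideal.subset_span ⟨_, ⟨rows, cols, rfl⟩, hlt⟩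
  have := Ideal.mul_mem_left _
    (monomial (m - ∑ i, Finsupp.single (C (rows i) (cols i)) 1) a) hmem
  rwa [monomial_mul, mul_one, tsub_add_cancel_of_le hle] at this

end PageLayout

/-! ### The layout of a bipartite quiver -/

namespace BipartiteQuiver

variable {V : Type*} [Quiver V] {r : ℕ} (Q : BipartiteQuiver V r) (m : V → ℕ)
  {M : ℕ} (hM : ∀ γ, m γ ≤ M)

/-- The pages of the quiver, as top left corners of square pages of size `M`. -/
def layout (M : ℕ) : PageLayout (Fin r) (Fin M) (Fin M) V V where
  tgt := Q.tgt
  src := Q.src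
  cells := {p | (p.2.1 : ℕ) < m (Q.tgt p.1) ∧ (p.2.2 : ℕ) < m (Q.src p.1)}
  rect_tgt h h' e := ⟨lt_of_lt_of_eq h.1 (congrArg m e), h'.2⟩
  rect_src h h' e := ⟨h'.1, lt_of_lt_of_eq h.2 (congrArg m e)⟩

/-- The cell of a variable. -/
def cell (x : Q.Var m) : Fin r × Fin M × Fin M :=
  (x.page, Fin.castLE (hM _) x.row, Fin.castLE (hM _) x.col)

theorem cell_injective : Function.Injective (Q.cell m hM) := by
  rintro ⟨k, i, j⟩ ⟨k', i', j'⟩ h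
  simp only [cell, Prod.mk.injEq] at h
  obtain ⟨rfl, h1, h2⟩ := h
  rw [Fin.castLE_injective _ h1, Fin.castLE_injective _ h2]

theorem layout_cells_eq : (Q.layout m M).cells = Set.range (Q.cell m hM) := by
  ext ⟨k, i, j⟩
  constructor
  · intro h
    exact ⟨⟨k, ⟨i, h.1⟩, ⟨j, h.2⟩⟩, rfl⟩
  · rintro ⟨x, hx⟩
    rw [← hx]
    exact ⟨x.row.2, x.col.2⟩

/-- The matrix of a sink, placed in the layout. -/
def sinkRepresents (α : V) : (Q.layout m M).Represents (Q.cell m hM) α (Q.sinkMatrix m α) where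
  row i := ⟨i, i.2.trans_le (hM _)⟩
  col c := toLex ((ofLex c).1.1, Fin.castLE (hM _) (ofLex c).2)
  row_strictMono _ _ h := h
  col_strictMono := by
    rintro ⟨⟨k, hk⟩, j⟩ ⟨⟨k', hk'⟩, j'⟩ h
    rw [Prod.Lex.toLex_lt_toLex]
    cases h with
    | left _ _ h => exact Or.inl h
    | right _ _ h => exact Or.inr ⟨rfl, h⟩
  apply_eq i c := rfl
  tgt_eq c := (ofLex c).1.2
  exists_eq v hv := by
    obtain ⟨k, i, j⟩ := v
    obtain rfl : Q.tgt k = α := hv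
    exact ⟨i, toLex ⟨⟨k, rfl⟩, j⟩, rfl⟩

/-- The transposed matrix of a source, placed in the transposed layout. -/
def sourceRepresents (β : V) : (Q.layout m M).transpose.Represents (fun x ↦ flip (Q.cell m hM x)) β
    (Q.sourceMatrix m β).transpose where
  row i := ⟨i, i.2.trans_le (hM _)⟩
  col c := toLex ((ofLex c).1.1, Fin.castLE (hM _) (ofLex c).2)
  row_strictMono _ _ h := h
  col_strictMono := by
    rintro ⟨⟨k, hk⟩, j⟩ ⟨⟨k', hk'⟩, j'⟩ h
    rw [Prod.Lex.toLex_lt_toLex]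
    cases h with
    | left _ _ h => exact Or.inl h
    | right _ _ h => exact Or.inr ⟨rfl, h⟩
  apply_eq i c := rfl
  tgt_eq c := (ofLex c).1.2
  exists_eq v hv := by
    obtain ⟨k, i, j⟩ := v
    obtain rfl : Q.src k = β := hv
    exact ⟨j, toLex ⟨⟨k, rfl⟩, i⟩, rfl⟩

theorem finite_var [Finite V] : Finite (Q.Var m) := by
  obtain ⟨M, hM⟩ := (Set.finite_range m).bddAbove
  exact Finite.of_injective _ (Q.cell_injective m fun γ ↦ hM ⟨γ, rfl⟩)

theorem finite_minors {ρ κ R : Type*} [LinearOrder ρ] [LinearOrder κ] [CommRing R] [Finite ρ]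
    [Finite κ] (n : ℕ) (A : Matrix ρ κ R) : (minors n A).Finite := by
  have hρ : Finite (Fin n ↪o ρ) := Finite.of_injective _ DFunLike.coe_injective
  have hκ : Finite (Fin n ↪o κ) := Finite.of_injective _ DFunLike.coe_injective
  refine (Set.finite_range fun e : (Fin n ↪o ρ) × (Fin n ↪o κ) ↦
    (A.submatrix e.1 e.2).det).subset ?_
  rintro f ⟨rows, cols, rfl⟩
  exact ⟨(rows, cols), rfl⟩

theorem finite_naturalGenerators [Finite V] (u : V → ℕ) (K : Type*) [Field K] :
    (Q.naturalGenerators m u K).Finite := by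
  have h1 : ∀ α : V, Finite (Σₗ k : {k : Fin r // Q.tgt k = α}, Fin (m (Q.src k))) := fun α ↦
    inferInstanceAs (Finite (Σ k : {k : Fin r // Q.tgt k = α}, Fin (m (Q.src k))))
  have h2 : ∀ β : V, Finite (Σₗ k : {k : Fin r // Q.src k = β}, Fin (m (Q.tgt k))) := fun β ↦
    inferInstanceAs (Finite (Σ k : {k : Fin r // Q.src k = β}, Fin (m (Q.tgt k))))
  refine Set.Finite.union ?_ ?_
  · exact (Set.toFinite _).biUnion fun α _ ↦ finite_minors _ _
  · exact (Set.toFinite _).biUnion fun β _ ↦ finite_minors _ _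

variable {m} {u : V → ℕ} {K : Type*} [Field K]

/-- The elements of the bipartite determinantal ideal vanish on all points that satisfy the rank
conditions. -/
theorem aeval_eq_zero_of_mem {L : Type*} [Field L] [Algebra K L] {f : MvPolynomial (Q.Var m) K}
    (hf : f ∈ Q.bipartiteDeterminantalIdeal m u K) {x : Fin r → Fin M → Fin M → L}
    (hx : x ∈ (Q.layout m M).Points u u L ∅ (Set.range (Q.cell m hM))) :
    aeval (fun v ↦ PageLayout.valueAt x (Q.cell m hM v)) f = 0 := by
  have hle : Q.bipartiteDeterminantalIdeal m u K ≤
      RingHom.ker (aeval (R := K) fun v ↦ PageLayout.valueAt x (Q.cell m hM v)) := by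
    refine Ideal.span_le.2 ?_
    rintro g (hg | hg)
    · simp only [Set.mem_iUnion] at hg
      obtain ⟨α, -, hg⟩ := hg
      exact (Q.sinkRepresents m hM α).aeval_minor_eq_zero hx.2.1 hg
    · simp only [Set.mem_iUnion] at hg
      obtain ⟨β, -, hg⟩ := hg
      rw [← minors_transpose] at hg
      have h := hx.2.2
      rw [Set.image_empty, ← Set.range_comp] at h
      exact (Q.sourceRepresents m hM β).aeval_minor_eq_zero h hg
  exact hle hf

/-- The leading term of every element of the bipartite determinantal ideal is divisible by the
leading term of a natural generator. -/
theorem leadingTerm_mem [Finite V] {mo : MonomialOrder (Q.Var m)} (hlex : IsLexicographic mo)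
    (hcons : Q.IsConsistentWithAll m mo) {f : MvPolynomial (Q.Var m) K}
    (hf : f ∈ Q.bipartiteDeterminantalIdeal m u K) :
    mo.leadingTerm f ∈ Ideal.span (mo.leadingTerm '' Q.naturalGenerators m u K) := by
  by_cases hf0 : f = 0
  · simp [hf0, MonomialOrder.leadingTerm]
  obtain ⟨M, hM'⟩ := (Set.finite_range m).bddAbove
  have hM : ∀ γ, m γ ≤ M := fun γ ↦ hM' ⟨γ, rfl⟩
  have := Q.finite_var m
  have : Fintype (Q.Var m) := Fintype.ofFinite _
  have hlong := PageLayout.hasLongChain_of_vanishing (D := Q.layout m M) (u := u) (v := u)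
    (L := AlgebraicClosure K) hlex (Q.cell_injective m hM) (Q.layout_cells_eq m hM)
    (fun p q hpq ↦ (Q.sinkRepresents m hM _).eq_or_varLT
      (hcons.1 _ (Q.right_mem q.page)) rfl hpq)
    (fun p q hpq ↦ (Q.sourceRepresents m hM _).eq_or_varLT
      (hcons.2 _ (Q.left_mem q.page)).transpose rfl hpq)
    Finset.univ ∅ (fun _ _ _ _ ↦ Finset.mem_univ _) (fun _ h ↦ h.elim) hf0
    (Finset.subset_univ _) (fun x hx ↦ by
      rw [Finset.coe_univ, Set.image_univ, Set.image_empty] at hx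
      exact Q.aeval_eq_zero_of_mem hM hf hx)
  rw [Set.empty_union] at hlong
  rcases hlong with ⟨p, hp, hchain⟩ | ⟨p, hp, hchain⟩
  · obtain ⟨x, hx, rfl⟩ := hp
    refine Ideal.span_mono (Set.image_mono ?_) ((Q.sinkRepresents m hM _).monomial_mem_span hlex
      (hcons.1 _ (Q.right_mem x.page)) (mo.leadingCoeff f) ⟨x, hx, rfl⟩ rfl hchain)
    exact Set.subset_union_of_subset_left
      (Set.subset_biUnion_of_mem (u := fun α ↦ minors (u α + 1) (varMatrix K (Q.sinkMatrix m α)))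
        (Q.right_mem x.page)) _
  · obtain ⟨x, hx, rfl⟩ := hp
    rw [← Set.image_comp] at hchain
    refine Ideal.span_mono (Set.image_mono ?_)
      ((Q.sourceRepresents m hM _).monomial_mem_span hlex
      (hcons.2 _ (Q.left_mem x.page)).transpose (mo.leadingCoeff f) ⟨x, hx, rfl⟩ rfl hchain)
    refine Set.subset_union_of_subset_right ?_ _
    change minors _ (varMatrix K (Q.sourceMatrix m _)).transpose ⊆ _
    rw [minors_transpose]
    exact Set.subset_biUnion_of_mem
      (u := fun β ↦ minors (u β + 1) (varMatrix K (Q.sourceMatrix m β))) (Q.left_mem x.page)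

end BipartiteQuiver

end BipartiteDeterminantal

theorem theorem1p2 {V : Type*} [Finite V] [Quiver V] {r : ℕ}
    (Q : BipartiteDeterminantal.BipartiteQuiver V r) (m u : V → ℕ)
    (K : Type*) [Field K] (mo : MonomialOrder (Q.Var m))
    (hlex : BipartiteDeterminantal.IsLexicographic mo)
    (hcons : Q.IsConsistentWithAll m mo) :
    BipartiteDeterminantal.IsGroebnerBasis mo (Q.bipartiteDeterminantalIdeal m u K)
      (Q.naturalGenerators m u K) where
  finite := Q.finite_naturalGenerators m u K
  span_eq := rfl
  initialIdeal_eq := by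
    refine le_antisymm (Ideal.span_le.2 ?_) (Ideal.span_mono (Set.image_mono Ideal.subset_span))
    rintro _ ⟨f, hf, rfl⟩
    exact Q.leadingTerm_mem hlex hcons hf
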